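/- Let $m,q,r\in\mathbb{N}=\{0,1,2,\dots\}$, let $\mathcal{B}$ be an arbitrary real matrix of dimension $(m+q)\times(m+r)$, and let $p\in[1,\infty)$. Consider the real Banach space $$X_p:=\bigl(L^p(0,1)\bigr)^{m}\times\bigl(L^p(0,\infty)\bigr)^{q}\times\bigl(L^p(0,\infty)\bigr)^{r},$$ equipped with any of the usual (equivalent) product norms, and write its elements as $(u,v,w)$ with $u=(u_j)_{j=1}^m$, $v=(v_j)_{j=1}^q$, $w=(w_j)_{j=1}^r$. Let the operator $(A_p,D(A_p))$ in $X_p$ be defined by $$A_p:=\operatorname{diag}(\underbrace{-\partial_x,\ldots,-\partial_x}_{m+q\text{ times}},\underbrace{\partial_x,\ldots,\partial_x}_{r\text{ times}}),\qquad\text{i.e. } A_p(u,v,w)=(-u',-v',w'),$$ $$D(A_p):=\left\{(u,v,w)\in \bigl(W^{1,p}(0,1)\bigr)^{m}\times\bigl(W^{1,p}(0,\infty)\bigr)^{q}\times\bigl(W^{1,p}(0,\infty)\bigr)^{r}:\ \binom{u(0)}{v(0)}=\mathcal{B}\binom{u(1)}{w(0)}\right\},$$ where $\partial_x$ is the weak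 derivative and the boundary values are those of the continuous representatives. Then $(A_p,D(A_p))$ generates a strongly continuous semigroup on $X_p$: there is a family $(T(t))_{t\ge 0}$ of bounded linear operators on $X_p$ with $T(0)=I$, $T(s+t)=T(s)T(t)$ for all $s,t\ge 0$, and $t\mapsto T(t)f$ continuous on $[0,\infty)$ for every $f\in X_p$, such that for all $f,g\in X_p$: $f\in D(A_p)$ and $A_pf=g$ if and only if $\lim_{t\to0^+}t^{-1}(T(t)f-f)=g$ in $X_p$. -/

import Mathlib

open MeasureTheory Filter Topology TopologicalSpace
open scoped ENNReal NNReal ContDiff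

noncomputable section

namespace NetworkTransport

/-- A strongly continuous (C₀-) semigroup of bounded linear operators on a real normed space `X`. -/
structure C0Semigroup (X : Type*) [NormedAddCommGroup X] [NormedSpace ℝ X] where
  /-- the family of operators `T(t)`, `t ≥ 0` -/
  T : ℝ≥0 → X →L[ℝ] X
  map_zero : T 0 = ContinuousLinearMap.id ℝ X
  map_add : ∀ s t : ℝ≥0, T (s + t) = (T s).comp (T t)
  continuous_orbit : ∀ x : X, Continuous fun t : ℝ≥0 => T t x

/-- The (unbounded) operator `A` is the infinitesimal generator of the semigroup `S`:
`x` lies in the domain of `A` and `A x = y` exactly if `t⁻¹ (T(t) x - x) → y` as `t → 0+`.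
In particular the domain of `A` is the set of all `x` for which this limit exists. -/
def C0Semigroup.IsGenerator {X : Type*} [NormedAddCommGroup X] [NormedSpace ℝ X]
    (S : C0Semigroup X) (A : X →ₗ.[ℝ] X) : Prop :=
  ∀ x y : X, (∃ hx : x ∈ A.domain, A ⟨x, hx⟩ = y) ↔
    Tendsto (fun t : ℝ≥0 => (t : ℝ)⁻¹ • (S.T t x - x)) (𝓝[>] 0) (𝓝 y)

/-- The operator `A` generates a strongly continuous semigroup. -/
def GeneratesC0Semigroup {X : Type*} [NormedAddCommGroup X] [NormedSpace ℝ X]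
    (A : X →ₗ.[ℝ] X) : Prop :=
  ∃ S : C0Semigroup X, S.IsGenerator A

/-- The real Lebesgue space `L^p(Ω)` for an open set `Ω ⊆ ℝ`, with Lebesgue measure. -/
abbrev LpOn (p : ℝ≥0∞) (Ω : Opens ℝ) : Type :=
  Lp ℝ p (volume.restrict (Ω : Set ℝ))

/-- `g` is the weak derivative of `f` on `Ω`: `∫_Ω f φ' = - ∫_Ω g φ` for all test functions
`φ ∈ C_c^∞(Ω)`. -/
def HasWeakDeriv {p : ℝ≥0∞} {Ω : Opens ℝ} (f g : LpOn p Ω) : Prop :=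
  ∀ φ : ℝ → ℝ, ContDiff ℝ ∞ φ → HasCompactSupport φ → tsupport φ ⊆ (Ω : Set ℝ) →
    ∫ x in (Ω : Set ℝ), f x * deriv φ x = - ∫ x in (Ω : Set ℝ), g x * φ x

section Helpers

variable {p : ℝ≥0∞} {Ω : Opens ℝ}

theorem integrable_mul_test [Fact (1 ≤ p)] (f : LpOn p Ω) {ψ : ℝ → ℝ} (hc : Continuous ψ)
    (hs : HasCompactSupport ψ) :
    Integrable (fun x => f x * ψ x) (volume.restrict (Ω : Set ℝ)) := by
  have hf : LocallyIntegrable f (volume.restrict (Ω : Set ℝ)) :=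
    (Lp.memLp f).locallyIntegrable Fact.out
  have h := hf.integrable_smul_left_of_hasCompactSupport hc hs
  refine h.congr (Eventually.of_forall fun x => ?_)
  simp [mul_comm]

theorem integrable_mul_deriv_test [Fact (1 ≤ p)] (f : LpOn p Ω) {φ : ℝ → ℝ} (hc : ContDiff ℝ ∞ φ)
    (hs : HasCompactSupport φ) :
    Integrable (fun x => f x * deriv φ x) (volume.restrict (Ω : Set ℝ)) :=
  integrable_mul_test f (hc.continuous_deriv (by simp)) hs.deriv

theorem HasWeakDeriv.add [Fact (1 ≤ p)] {f₁ f₂ g₁ g₂ : LpOn p Ω} (h₁ : HasWeakDeriv f₁ g₁)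
    (h₂ : HasWeakDeriv f₂ g₂) : HasWeakDeriv (f₁ + f₂) (g₁ + g₂) := by
  intro φ hc hs ht
  have e₁ : ∫ x in (Ω : Set ℝ), (f₁ + f₂ : LpOn p Ω) x * deriv φ x
      = ∫ x in (Ω : Set ℝ), (f₁ x * deriv φ x + f₂ x * deriv φ x) := by
    refine integral_congr_ae ?_
    filter_upwards [Lp.coeFn_add f₁ f₂] with x hx
    rw [hx, Pi.add_apply, add_mul]
  have e₂ : ∫ x in (Ω : Set ℝ), (g₁ + g₂ : LpOn p Ω) x * φ x
      = ∫ x in (Ω : Set ℝ), (g₁ x * φ x + g₂ x * φ x) := by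
    refine integral_congr_ae ?_
    filter_upwards [Lp.coeFn_add g₁ g₂] with x hx
    rw [hx, Pi.add_apply, add_mul]
  rw [e₁, e₂, integral_add (integrable_mul_deriv_test f₁ hc hs)
    (integrable_mul_deriv_test f₂ hc hs),
    integral_add (integrable_mul_test g₁ hc.continuous hs)
    (integrable_mul_test g₂ hc.continuous hs), h₁ φ hc hs ht, h₂ φ hc hs ht]
  ring

theorem HasWeakDeriv.smul {f g : LpOn p Ω} (c : ℝ) (h : HasWeakDeriv f g) :
    HasWeakDeriv (c • f) (c • g) := by
  intro φ hc hs ht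
  have e₁ : ∫ x in (Ω : Set ℝ), (c • f : LpOn p Ω) x * deriv φ x
      = ∫ x in (Ω : Set ℝ), c * (f x * deriv φ x) := by
    refine integral_congr_ae ?_
    filter_upwards [Lp.coeFn_smul c f] with x hx
    rw [hx, Pi.smul_apply, smul_eq_mul, mul_assoc]
  have e₂ : ∫ x in (Ω : Set ℝ), (c • g : LpOn p Ω) x * φ x
      = ∫ x in (Ω : Set ℝ), c * (g x * φ x) := by
    refine integral_congr_ae ?_
    filter_upwards [Lp.coeFn_smul c g] with x hx
    rw [hx, Pi.smul_apply, smul_eq_mul, mul_assoc]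
  rw [e₁, e₂, integral_const_mul, integral_const_mul, h φ hc hs ht]
  ring

theorem HasWeakDeriv.zero : HasWeakDeriv (0 : LpOn p Ω) 0 := by
  intro φ hc hs ht
  have h := fun ψ : ℝ → ℝ => integral_congr_ae (μ := volume.restrict (Ω : Set ℝ))
    (f := fun x => (0 : LpOn p Ω) x * ψ x) (g := fun _ => 0) (by
      filter_upwards [Lp.coeFn_zero ℝ p (volume.restrict (Ω : Set ℝ))] with x hx
      rw [hx, Pi.zero_apply, zero_mul])
  rw [h (deriv φ), h φ]
  simp

theorem HasWeakDeriv.unique [Fact (1 ≤ p)] {f g₁ g₂ : LpOn p Ω} (h₁ : HasWeakDeriv f g₁)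
    (h₂ : HasWeakDeriv f g₂) : g₁ = g₂ := by
  have hd : HasWeakDeriv (f + (-1 : ℝ) • f) (g₁ + (-1 : ℝ) • g₂) := h₁.add (h₂.smul (-1))
  have hf : f + (-1 : ℝ) • f = 0 := by simp
  rw [hf] at hd
  set g : LpOn p Ω := g₁ + (-1 : ℝ) • g₂ with hg
  have hloc : LocallyIntegrableOn g (Ω : Set ℝ) volume := by
    exact locallyIntegrableOn_of_locallyIntegrable_restrict
      ((Lp.memLp g).locallyIntegrable Fact.out)
  have hae := Ω.isOpen.ae_eq_zero_of_integral_contDiff_smul_eq_zero hloc (by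
    intro φ hc hs ht
    have h := hd φ hc hs ht
    have h0 : ∫ x in (Ω : Set ℝ), (0 : LpOn p Ω) x * deriv φ x = 0 := by
      rw [← integral_zero ℝ ℝ (μ := volume.restrict (Ω : Set ℝ))]
      refine integral_congr_ae ?_
      filter_upwards [Lp.coeFn_zero ℝ p (volume.restrict (Ω : Set ℝ))] with x hx
      rw [hx, Pi.zero_apply, zero_mul]
    rw [h0, eq_comm, neg_eq_zero] at h
    rw [← h, ← setIntegral_eq_integral_of_forall_compl_eq_zero (s := (Ω : Set ℝ))]
    · exact integral_congr_ae (Eventually.of_forall fun x => by simp [mul_comm])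
    · intro x hx
      have : φ x = 0 := image_eq_zero_of_notMem_tsupport fun hx' => hx (ht hx')
      simp [this])
  have hz : g = 0 := by
    rw [Lp.eq_zero_iff_ae_eq_zero]
    exact (ae_restrict_iff' Ω.isOpen.measurableSet).mpr hae
  rw [hg] at hz
  simpa [← sub_eq_add_neg, sub_eq_zero] using hz

end Helpers

/-- The Sobolev space `W^{1,p}(Ω)`: functions in `L^p(Ω)` with a weak derivative in `L^p(Ω)`. -/
def W1p (p : ℝ≥0∞) [Fact (1 ≤ p)] (Ω : Opens ℝ) : Submodule ℝ (LpOn p Ω) where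
  carrier := {f | ∃ g : LpOn p Ω, HasWeakDeriv f g}
  zero_mem' := ⟨0, HasWeakDeriv.zero⟩
  add_mem' := by
    rintro _ _ ⟨g₁, h₁⟩ ⟨g₂, h₂⟩
    exact ⟨g₁ + g₂, h₁.add h₂⟩
  smul_mem' := by
    rintro c _ ⟨g, h⟩
    exact ⟨c • g, h.smul c⟩

/-- The weak derivative `∂ₓ : W^{1,p}(Ω) → L^p(Ω)`. -/
def weakDeriv (p : ℝ≥0∞) [Fact (1 ≤ p)] (Ω : Opens ℝ) : W1p p Ω →ₗ[ℝ] LpOn p Ω where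
  toFun f := f.2.choose
  map_add' f₁ f₂ := (f₁ + f₂).2.choose_spec.unique (f₁.2.choose_spec.add f₂.2.choose_spec)
  map_smul' c f := (c • f).2.choose_spec.unique (f.2.choose_spec.smul c)

theorem weakDeriv_spec {p : ℝ≥0∞} [Fact (1 ≤ p)] {Ω : Opens ℝ} (f : W1p p Ω) :
    HasWeakDeriv (f : LpOn p Ω) (weakDeriv p Ω f) :=
  f.2.choose_spec

/-- The value at `a ∈ closure Ω` of (the continuous representative of) `f` is `c`: some function
which is continuous on the closure of `Ω` and equal to `f` almost everywhere on `Ω` takes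
the value `c` at `a`. -/
def HasValueAt {p : ℝ≥0∞} {Ω : Opens ℝ} (f : LpOn p Ω) (a c : ℝ) : Prop :=
  ∃ F : ℝ → ℝ, ContinuousOn F (closure (Ω : Set ℝ)) ∧
    f =ᵐ[volume.restrict (Ω : Set ℝ)] F ∧ F a = c

theorem HasValueAt.zero {p : ℝ≥0∞} {Ω : Opens ℝ} (a : ℝ) : HasValueAt (0 : LpOn p Ω) a 0 :=
  ⟨0, continuousOn_const, Lp.coeFn_zero _ _ _, rfl⟩

theorem HasValueAt.add {p : ℝ≥0∞} {Ω : Opens ℝ} {f₁ f₂ : LpOn p Ω} {a c₁ c₂ : ℝ}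
    (h₁ : HasValueAt f₁ a c₁) (h₂ : HasValueAt f₂ a c₂) : HasValueAt (f₁ + f₂) a (c₁ + c₂) := by
  obtain ⟨F₁, k₁, e₁, rfl⟩ := h₁
  obtain ⟨F₂, k₂, e₂, rfl⟩ := h₂
  exact ⟨F₁ + F₂, k₁.add k₂, (Lp.coeFn_add f₁ f₂).trans (e₁.add e₂), rfl⟩

theorem HasValueAt.smul {p : ℝ≥0∞} {Ω : Opens ℝ} {f : LpOn p Ω} {a c : ℝ} (k : ℝ)
    (h : HasValueAt f a c) : HasValueAt (k • f) a (k * c) := by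
  obtain ⟨F, hF, e, rfl⟩ := h
  exact ⟨k • F, hF.const_smul k, (Lp.coeFn_smul k f).trans (e.const_smul k), rfl⟩

/-- The open interval `(0,1)`. -/
def unitInterval : Opens ℝ := ⟨Set.Ioo 0 1, isOpen_Ioo⟩

/-- The open half-line `(0,∞)`. -/
def halfLine : Opens ℝ := ⟨Set.Ioi 0, isOpen_Ioi⟩

/-- The space `X_p = L^p(0,1)^m × L^p(0,∞)^(q+r)`, whose elements are triples `(u, v, w)`;
it carries the maximum of the norms of the components, which is equivalent to
any other product norm. -/
abbrev StateSpace (p : ℝ≥0∞) (m q r : ℕ) : Type :=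
  (Fin m → LpOn p unitInterval) × (Fin q → LpOn p halfLine) × (Fin r → LpOn p halfLine)

/-- The boundary condition `(u(0), v(0)) = B (u(1), w(0))`. -/
def BoundaryCondition {p : ℝ≥0∞} {m q r : ℕ}
    (B : Matrix (Fin m ⊕ Fin q) (Fin m ⊕ Fin r) ℝ) (f : StateSpace p m q r) : Prop :=
  ∃ (u₀ u₁ : Fin m → ℝ) (v₀ : Fin q → ℝ) (w₀ : Fin r → ℝ),
    (∀ j, HasValueAt (f.1 j) 0 (u₀ j)) ∧ (∀ j, HasValueAt (f.1 j) 1 (u₁ j)) ∧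
    (∀ j, HasValueAt (f.2.1 j) 0 (v₀ j)) ∧ (∀ j, HasValueAt (f.2.2 j) 0 (w₀ j)) ∧
    Sum.elim u₀ v₀ = B.mulVec (Sum.elim u₁ w₀)

/-- The domain `D(A_p)`: triples of `W^{1,p}` functions which satisfy the boundary condition. -/
def transportDomain (p : ℝ≥0∞) [Fact (1 ≤ p)] {m q r : ℕ}
    (B : Matrix (Fin m ⊕ Fin q) (Fin m ⊕ Fin r) ℝ) : Submodule ℝ (StateSpace p m q r) where
  carrier := {f | (∀ j, f.1 j ∈ W1p p unitInterval) ∧ (∀ j, f.2.1 j ∈ W1p p halfLine) ∧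
    (∀ j, f.2.2 j ∈ W1p p halfLine) ∧ BoundaryCondition B f}
  zero_mem' := by
    refine ⟨fun _ => zero_mem _, fun _ => zero_mem _, fun _ => zero_mem _, 0, 0, 0, 0,
      fun _ => .zero _, fun _ => .zero _, fun _ => .zero _, fun _ => .zero _, ?_⟩
    have h : ∀ n k : ℕ, Sum.elim (0 : Fin n → ℝ) (0 : Fin k → ℝ) = 0 := by
      intro n k
      ext (i | i) <;> rfl
    rw [h, h, Matrix.mulVec_zero]
  add_mem' := by
    rintro f g ⟨hu, hv, hw, u₀, u₁, v₀, w₀, h1, h2, h3, h4, h5⟩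
      ⟨hu', hv', hw', u₀', u₁', v₀', w₀', h1', h2', h3', h4', h5'⟩
    refine ⟨fun j => add_mem (hu j) (hu' j), fun j => add_mem (hv j) (hv' j),
      fun j => add_mem (hw j) (hw' j), u₀ + u₀', u₁ + u₁', v₀ + v₀', w₀ + w₀',
      fun j => (h1 j).add (h1' j), fun j => (h2 j).add (h2' j), fun j => (h3 j).add (h3' j),
      fun j => (h4 j).add (h4' j), ?_⟩
    have h : ∀ (n k : ℕ) (a b : Fin n → ℝ) (c d : Fin k → ℝ),
        Sum.elim (a + b) (c + d) = Sum.elim a c + Sum.elim b d := by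
      intro n k a b c d
      ext (i | i) <;> rfl
    rw [h, h, Matrix.mulVec_add, h5, h5']
  smul_mem' := by
    rintro k f ⟨hu, hv, hw, u₀, u₁, v₀, w₀, h1, h2, h3, h4, h5⟩
    refine ⟨fun j => Submodule.smul_mem _ k (hu j), fun j => Submodule.smul_mem _ k (hv j),
      fun j => Submodule.smul_mem _ k (hw j), k • u₀, k • u₁, k • v₀, k • w₀,
      fun j => (h1 j).smul k, fun j => (h2 j).smul k, fun j => (h3 j).smul k,
      fun j => (h4 j).smul k, ?_⟩
    have h : ∀ (n l : ℕ) (a : Fin n → ℝ) (c : Fin l → ℝ),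
        Sum.elim (k • a) (k • c) = k • Sum.elim a c := by
      intro n l a c
      ext (i | i) <;> rfl
    rw [h, h, Matrix.mulVec_smul, h5]

/-- The action `(u, v, w) ↦ (-u', -v', w')` on the domain `D(A_p)`, with weak derivatives. -/
def transportAction (p : ℝ≥0∞) [Fact (1 ≤ p)] {m q r : ℕ}
    (B : Matrix (Fin m ⊕ Fin q) (Fin m ⊕ Fin r) ℝ) :
    transportDomain p B →ₗ[ℝ] StateSpace p m q r :=
  let incl := (transportDomain p B).subtype
  let u (j : Fin m) : transportDomain p B →ₗ[ℝ] W1p p unitInterval :=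
    ((LinearMap.proj j ∘ₗ LinearMap.fst ℝ _ _) ∘ₗ incl).codRestrict _ fun f => f.2.1 j
  let v (j : Fin q) : transportDomain p B →ₗ[ℝ] W1p p halfLine :=
    ((LinearMap.proj j ∘ₗ LinearMap.fst ℝ _ _ ∘ₗ LinearMap.snd ℝ _ _) ∘ₗ incl).codRestrict _
      fun f => f.2.2.1 j
  let w (j : Fin r) : transportDomain p B →ₗ[ℝ] W1p p halfLine :=
    ((LinearMap.proj j ∘ₗ LinearMap.snd ℝ _ _ ∘ₗ LinearMap.snd ℝ _ _) ∘ₗ incl).codRestrict _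
      fun f => f.2.2.2.1 j
  (LinearMap.pi fun j => -(weakDeriv p unitInterval ∘ₗ u j)).prod
    ((LinearMap.pi fun j => -(weakDeriv p halfLine ∘ₗ v j)).prod
      (LinearMap.pi fun j => weakDeriv p halfLine ∘ₗ w j))

/-- The operator `A_p = diag(-∂ₓ, …, -∂ₓ, ∂ₓ, …, ∂ₓ)` in `X_p` with domain `D(A_p)`. -/
def transportOperator (p : ℝ≥0∞) [Fact (1 ≤ p)] {m q r : ℕ}
    (B : Matrix (Fin m ⊕ Fin q) (Fin m ⊕ Fin r) ℝ) :
    StateSpace p m q r →ₗ.[ℝ] StateSpace p m q r where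
  domain := transportDomain p B
  toFun := transportAction p B

end NetworkTransport

end

/-!
The semigroup is written down explicitly for times `t ≤ 1`. Prolong each of the components `u_j`
and `v_j`, which are transported to the right, to the left of `0` by the values that the boundary
condition will send into the edge: at `-t` the prolongation is the corresponding entry of
`B (u(1 - t), w(t))`. This is a bounded operator `prolong B` from the state space to `L^p(ℝ)`, and
`evolve B t` translates the prolonged components by `t` to the right, the components `w_j` by `t`
to the left, and restricts the result. Strong continuity is that of translations of `L^p(ℝ)`
(`continuous_shift`), and the semigroup law holds as long as the times add up to at most `1`,
because prolonging an evolved state gives the translated prolongation (`evolve_add`). Such a local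
semigroup extends to a semigroup (`exists_c0Semigroup_eq_of_lt_one`), and its generator depends on
small times only.

For the generator, suppose first that the difference quotients of `f` converge to `g`. Pairing them
with test functions shows that `f` has the weak derivatives prescribed by `g`
(`hasWeakDeriv_of_tendsto`). So in both directions one may assume that `f` has these derivatives;
then `f` is the primitive of its derivative (`HasWeakDeriv.exists_ae_eq_primitive`), and each
prolonged component is a primitive of one and the same `L^p` function on both sides of `0`, with
constants which are the two sides of the boundary condition. If they agree, the difference quotients
are averages of translates of this function, and converge (`tendsto_of_increment`). If not, there is
a jump at `0`, and the difference quotients of a jump do not converge in `L^p`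
(`not_tendsto_leftIndicator`). Hence the difference quotients converge exactly if the boundary
condition is satisfied (`tendsto_iff_boundaryCondition`).
-/

namespace NetworkTransport

/-! ### Extending a local semigroup -/

section LocalSemigroup

variable {X : Type*} [NormedAddCommGroup X] [NormedSpace ℝ X]

/-- A family of operators obeying the semigroup law as long as the times add up to at most `1`
is, on `[0, 1)`, a strongly continuous semigroup: put `S(n + a) = T(1)ⁿ T(a)`. -/
theorem exists_c0Semigroup_eq_of_lt_one (T : ℝ≥0 → X →L[ℝ] X)
    (h0 : T 0 = ContinuousLinearMap.id ℝ X)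
    (hadd : ∀ s t : ℝ≥0, s + t ≤ 1 → T (s + t) = (T s).comp (T t))
    (hc : ∀ x : X, Continuous fun t : ℝ≥0 => T t x) :
    ∃ S : C0Semigroup X, ∀ t < 1, S.T t = T t := by
  have hcomm : ∀ a ≤ (1 : ℝ≥0), Commute (T 1) (T a) := by
    intro a ha
    have h1 : T 1 = T a * T (1 - a) := by
      have := hadd a (1 - a) (by rw [add_tsub_cancel_of_le ha])
      rwa [add_tsub_cancel_of_le ha] at this
    have h2 : T 1 = T (1 - a) * T a := by
      have := hadd (1 - a) a (by rw [tsub_add_cancel_of_le ha])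
      rwa [tsub_add_cancel_of_le ha] at this
    calc T 1 * T a = T a * T (1 - a) * T a := by rw [← h1]
      _ = T a * T 1 := by rw [mul_assoc, ← h2]
  set S : ℝ≥0 → X →L[ℝ] X := fun t => T 1 ^ ⌊t⌋₊ * T (t - ⌊t⌋₊) with hS
  -- The formula for `S` also holds at the right end point of each unit interval.
  have key : ∀ (n : ℕ) (a : ℝ≥0), a ≤ 1 → S (n + a) = T 1 ^ n * T a := by
    intro n a ha
    rcases ha.lt_or_eq with h | rfl
    · have hf : ⌊(n : ℝ≥0) + a⌋₊ = n := by
        rw [Nat.floor_eq_iff (by positivity)]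
        exact ⟨le_self_add, by gcongr⟩
      simp only [hS]
      rw [hf, add_tsub_cancel_left]
    · have hf : ⌊(n : ℝ≥0) + 1⌋₊ = n + 1 := by exact_mod_cast Nat.floor_natCast (n + 1)
      simp only [hS]
      rw [hf, Nat.cast_add, Nat.cast_one, tsub_self, h0, pow_succ]
      rfl
  have hdec : ∀ t : ℝ≥0, ∃ (n : ℕ) (a : ℝ≥0), a < 1 ∧ t = n + a := by
    intro t
    refine ⟨⌊t⌋₊, t - ⌊t⌋₊, ?_, (add_tsub_cancel_of_le (Nat.floor_le zero_le)).symm⟩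
    rw [tsub_lt_iff_left (Nat.floor_le zero_le)]
    exact Nat.lt_floor_add_one t
  have hcont : ∀ (x : X) (n : ℕ), ContinuousOn (fun t => S t x) (Set.Iic (n : ℝ≥0)) := by
    intro x n
    induction n with
    | zero =>
      have : Set.Iic ((0 : ℕ) : ℝ≥0) = {0} := by ext t; simp
      rw [this]
      exact continuousOn_singleton _ _
    | succ n ih =>
      have hpiece : ContinuousOn (fun t => S t x) (Set.Icc (n : ℝ≥0) ((n + 1 : ℕ) : ℝ≥0)) := by
        have : Continuous fun t : ℝ≥0 => (T 1 ^ n) (T (t - n) x) :=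
          (T 1 ^ n).continuous.comp ((hc x).comp (continuous_id.sub continuous_const))
        refine this.continuousOn.congr fun t ht => ?_
        have ha : t - n ≤ 1 := by
          rw [tsub_le_iff_left]; exact_mod_cast ht.2
        have := key n (t - n) ha
        rw [add_tsub_cancel_of_le ht.1] at this
        simp only [this]
        rfl
      have hu : Set.Iic (n : ℝ≥0) ∪ Set.Icc (n : ℝ≥0) ((n + 1 : ℕ) : ℝ≥0)
          = Set.Iic ((n + 1 : ℕ) : ℝ≥0) := Set.Iic_union_Icc_eq_Iic (by gcongr; omega)
      rw [← hu]
      exact ih.union_of_isClosed hpiece isClosed_Iic isClosed_Icc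
  refine ⟨⟨S, ?_, ?_, ?_⟩, ?_⟩
  · simpa [h0] using key 0 0 zero_le_one
  · intro s t
    obtain ⟨n, a, ha, rfl⟩ := hdec s
    obtain ⟨k, b, hb, rfl⟩ := hdec t
    change _ = S _ * S _
    rw [key n a ha.le, key k b hb.le]
    have hmul : T 1 ^ n * T a * (T 1 ^ k * T b) = T 1 ^ (n + k) * (T a * T b) := by
      have := ((hcomm a ha.le).pow_left k).eq
      rw [pow_add, mul_assoc, mul_assoc, ← mul_assoc (T a), ← this, mul_assoc (T 1 ^ k)]
    rw [hmul]
    rcases le_total (a + b) 1 with h | h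
    · have e : (n : ℝ≥0) + a + (k + b) = ((n + k : ℕ) : ℝ≥0) + (a + b) := by push_cast; ring
      rw [e, key _ _ h, hadd a b h]
      rfl
    -- With `a + b = 1 + c`, the remaining time `a` is split as `c + (1 - b)`.
    · obtain ⟨c, hc'⟩ := exists_add_of_le h
      have hcb : c + (1 - b) = a := by
        have hb' : b + (1 - b) = 1 := add_tsub_cancel_of_le hb.le
        have : b + (c + (1 - b)) = b + a := by
          rw [add_left_comm, hb', add_comm b a, hc', add_comm]
        exact add_left_cancel this
      have hcle : c ≤ 1 := le_trans (by rw [← hcb]; exact le_self_add) ha.le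
      have e : (n : ℝ≥0) + a + (k + b) = ((n + k + 1 : ℕ) : ℝ≥0) + c := by
        have : (n : ℝ≥0) + a + (k + b) = n + k + (a + b) := by ring
        rw [this, hc']; push_cast; ring
      have hab : T a * T b = T 1 * T c := by
        have h1 : T a = T c * T (1 - b) := by
          have := hadd c (1 - b) (by rw [hcb]; exact ha.le)
          rwa [hcb] at this
        have h2 : T 1 = T (1 - b) * T b := by
          have := hadd (1 - b) b (by rw [tsub_add_cancel_of_le hb.le])
          rwa [tsub_add_cancel_of_le hb.le] at this
        rw [h1, mul_assoc, ← h2, (hcomm c hcle).eq]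
      rw [e, key _ _ hcle, hab, pow_succ, mul_assoc]
  · intro x
    rw [continuous_iff_continuousAt]
    intro t
    obtain ⟨n, hn⟩ := exists_nat_gt t
    exact (hcont x n).continuousAt (Iic_mem_nhds hn)
  · intro t ht
    simpa using key 0 t ht.le

end LocalSemigroup

/-! ### Translations, reflection, extension by zero and restriction on `L^p` -/

section Operators

variable {p : ℝ≥0∞}

theorem LpOn.ext_ae {Ω : Opens ℝ} {f g : LpOn p Ω} (h : ∀ᵐ x, x ∈ Ω → f x = g x) : f = g :=
  Lp.ext ((ae_restrict_iff' Ω.isOpen.measurableSet).2 h)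

theorem Lp_sum_smul_ae {ι : Type*} (s : Finset ι) (c : ι → ℝ)
    (F : ι → Lp ℝ p (volume : Measure ℝ)) :
    ∀ᵐ x, (∑ k ∈ s, c k • F k : Lp ℝ p (volume : Measure ℝ)) x = ∑ k ∈ s, c k * F k x := by
  classical
  induction s using Finset.induction_on with
  | empty =>
    simp
  | insert a s ha ih =>
    rw [Finset.sum_insert ha]
    filter_upwards [ih, Lp.coeFn_add (c a • F a) (∑ k ∈ s, c k • F k),
      Lp.coeFn_smul (c a) (F a)] with x h1 h2 h3
    rw [h2, Pi.add_apply, h1, h3, Finset.sum_insert ha]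
    rfl

variable [Fact (1 ≤ p)]

/-- The translation `(shift c F)(x) = F (x - c)` on `L^p(ℝ)`. -/
noncomputable def shift (c : ℝ) : Lp ℝ p (volume : Measure ℝ) →L[ℝ] Lp ℝ p (volume : Measure ℝ) :=
  (Lp.compMeasurePreservingₗᵢ ℝ (fun x => x - c)
    (measurePreserving_sub_right volume c)).toContinuousLinearMap

/-- The reflection `(reflect F)(x) = F (-x)` on `L^p(ℝ)`. -/
noncomputable def reflect : Lp ℝ p (volume : Measure ℝ) →L[ℝ] Lp ℝ p (volume : Measure ℝ) :=
  (Lp.compMeasurePreservingₗᵢ ℝ (fun x => -x)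
    (Measure.measurePreserving_neg volume)).toContinuousLinearMap

/-- Restriction `L^p(ℝ) → L^p(Ω)`. -/
noncomputable def restr (Ω : Opens ℝ) : Lp ℝ p (volume : Measure ℝ) →L[ℝ] LpOn p Ω :=
  LpToLpRestrictCLM ℝ ℝ ℝ volume p (Ω : Set ℝ)

/-- Extension by zero `L^p(Ω) → L^p(ℝ)`. -/
noncomputable def zeroExt (Ω : Opens ℝ) : LpOn p Ω →L[ℝ] Lp ℝ p (volume : Measure ℝ) :=
  LinearMap.mkContinuous
    { toFun := fun f => MemLp.toLp ((Ω : Set ℝ).indicator f)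
        ((memLp_indicator_iff_restrict Ω.isOpen.measurableSet).2 (Lp.memLp f))
      map_add' := by
        intro f g
        rw [← MemLp.toLp_add]
        refine MemLp.toLp_congr _ _ ?_
        have := (ae_restrict_iff' Ω.isOpen.measurableSet).1 (Lp.coeFn_add f g)
        filter_upwards [this] with x hx
        by_cases h : x ∈ (Ω : Set ℝ)
        · simpa [h] using hx h
        · simp [h]
      map_smul' := by
        intro c f
        rw [RingHom.id_apply, ← MemLp.toLp_const_smul]
        refine MemLp.toLp_congr _ _ ?_
        have := (ae_restrict_iff' Ω.isOpen.measurableSet).1 (Lp.coeFn_smul c f)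
        filter_upwards [this] with x hx
        by_cases h : x ∈ (Ω : Set ℝ)
        · simpa [h] using hx h
        · simp [h] }
    1 (fun f => by
      simp only [LinearMap.coe_mk, AddHom.coe_mk, one_mul]
      rw [Lp.norm_toLp, eLpNorm_indicator_eq_eLpNorm_restrict Ω.isOpen.measurableSet, Lp.norm_def])

theorem shift_ae (c : ℝ) (F : Lp ℝ p (volume : Measure ℝ)) :
    ∀ᵐ x, shift c F x = F (x - c) :=
  Lp.coeFn_compMeasurePreserving F (measurePreserving_sub_right volume c)

theorem reflect_ae (F : Lp ℝ p (volume : Measure ℝ)) : ∀ᵐ x, reflect F x = F (-x) :=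
  Lp.coeFn_compMeasurePreserving F (Measure.measurePreserving_neg volume)

theorem ae_comp_sub (c : ℝ) {P : ℝ → Prop} (h : ∀ᵐ x, P x) : ∀ᵐ x, P (x - c) :=
  (measurePreserving_sub_right volume c).quasiMeasurePreserving.ae h

theorem ae_comp_neg {P : ℝ → Prop} (h : ∀ᵐ x, P x) : ∀ᵐ x : ℝ, P (-x) :=
  (Measure.measurePreserving_neg volume).quasiMeasurePreserving.ae h

theorem restr_ae (Ω : Opens ℝ) (F : Lp ℝ p (volume : Measure ℝ)) :
    ∀ᵐ x, x ∈ Ω → restr Ω F x = F x :=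
  (ae_restrict_iff' Ω.isOpen.measurableSet).1 (LpToLpRestrictCLM_coeFn ℝ (Ω : Set ℝ) F)

theorem zeroExt_ae (Ω : Opens ℝ) (f : LpOn p Ω) :
    ∀ᵐ x, zeroExt Ω f x = (Ω : Set ℝ).indicator f x := by
  have h : MemLp ((Ω : Set ℝ).indicator f) p volume :=
    (memLp_indicator_iff_restrict Ω.isOpen.measurableSet).2 (Lp.memLp f)
  have e : zeroExt Ω f = h.toLp := rfl
  rw [e]
  exact h.coeFn_toLp

theorem zeroExt_restr_ae (Ω : Opens ℝ) (F : Lp ℝ p (volume : Measure ℝ)) :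
    ∀ᵐ x, zeroExt Ω (restr Ω F) x = (Ω : Set ℝ).indicator F x := by
  filter_upwards [zeroExt_ae Ω (restr Ω F), restr_ae Ω F] with x h1 h2
  by_cases h : x ∈ (Ω : Set ℝ)
  · rw [h1, Set.indicator_of_mem h, Set.indicator_of_mem h, h2 h]
  · rw [h1, Set.indicator_of_notMem h, Set.indicator_of_notMem h]

theorem restr_congr {Ω : Opens ℝ} {F G : Lp ℝ p (volume : Measure ℝ)}
    (h : ∀ᵐ x, x ∈ Ω → F x = G x) : restr Ω F = restr Ω G := by
  refine LpOn.ext_ae ?_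
  filter_upwards [h, restr_ae Ω F, restr_ae Ω G] with x h1 h2 h3 hx
  rw [h2 hx, h3 hx, h1 hx]

theorem restr_zeroExt (Ω : Opens ℝ) (f : LpOn p Ω) : restr Ω (zeroExt Ω f) = f := by
  refine LpOn.ext_ae ?_
  filter_upwards [zeroExt_ae Ω f, restr_ae Ω (zeroExt Ω f)] with x h1 h2 hx
  rw [h2 hx, h1, Set.indicator_of_mem hx]

theorem shift_shift (c d : ℝ) (F : Lp ℝ p (volume : Measure ℝ)) :
    shift c (shift d F) = shift (c + d) F := by
  refine Lp.ext ?_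
  filter_upwards [shift_ae c (shift d F), ae_comp_sub c (shift_ae d F), shift_ae (c + d) F]
    with x h1 h2 h3
  rw [h1, h2, h3]
  congr 1
  ring

theorem shift_zero (F : Lp ℝ p (volume : Measure ℝ)) : shift 0 F = F := by
  refine Lp.ext ?_
  filter_upwards [shift_ae 0 F] with x h1
  rw [h1, sub_zero]

/-- Translation is strongly continuous on `L^p(ℝ)`, `p < ∞`. -/
theorem continuous_shift (hp : p ≠ ⊤) (F : Lp ℝ p (volume : Measure ℝ)) :
    Continuous fun c : ℝ => shift c F := by
  let g : C(ℝ, C(ℝ, ℝ)) :=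
    (ContinuousMap.mk (fun a : ℝ × ℝ => a.2 - a.1) (by fun_prop)).curry
  exact Continuous.compMeasurePreservingLp (f := fun _ : ℝ => F) (g := g) continuous_const
    g.continuous (fun c => measurePreserving_sub_right volume c) hp

theorem norm_shift (c : ℝ) (F : Lp ℝ p (volume : Measure ℝ)) : ‖shift c F‖ = ‖F‖ :=
  Lp.norm_compMeasurePreserving F (measurePreserving_sub_right volume c)

theorem locallyIntegrable_lp (F : Lp ℝ p (volume : Measure ℝ)) : LocallyIntegrable F volume :=
  (Lp.memLp F).locallyIntegrable Fact.out

theorem intervalIntegrable_lp (F : Lp ℝ p (volume : Measure ℝ)) (a b : ℝ) :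
    IntervalIntegrable F volume a b :=
  intervalIntegrable_iff.2 (((locallyIntegrable_lp F).integrableOn_isCompact
    isCompact_uIcc).mono_set Set.uIoc_subset_uIcc)

/-- The pairing of `f ∈ L^p(Ω)` with a continuous function of compact support, as a bounded
linear functional of `f`. -/
theorem exists_pairing (Ω : Opens ℝ) {ψ : ℝ → ℝ} (hc : Continuous ψ) (hs : HasCompactSupport ψ) :
    ∃ L : LpOn p Ω →L[ℝ] ℝ, ∀ f, L f = ∫ x in (Ω : Set ℝ), f x * ψ x := by
  have := ENNReal.HolderConjugate.inv_one_sub_inv' (Fact.out : 1 ≤ p)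
  have : Fact (1 ≤ (1 - p⁻¹)⁻¹) := by simp [fact_iff]
  have hψ : MemLp ψ (1 - p⁻¹)⁻¹ (volume.restrict (Ω : Set ℝ)) :=
    (hc.memLp_of_hasCompactSupport hs).restrict _
  refine ⟨((ContinuousLinearMap.mul ℝ ℝ).lpPairing (volume.restrict (Ω : Set ℝ)) p
    (1 - p⁻¹)⁻¹).flip hψ.toLp, fun f => ?_⟩
  rw [ContinuousLinearMap.flip_apply, ContinuousLinearMap.lpPairing_eq_integral]
  refine integral_congr_ae ?_
  filter_upwards [hψ.coeFn_toLp] with x hx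
  rw [hx, ContinuousLinearMap.mul_apply']

end Operators

/-! ### Weak derivatives and primitives on intervals -/

section Sobolev

/-- A test function on an interval with integral zero is the derivative of a test function. -/
theorem exists_test_primitive {Ω : Set ℝ} (hΩ : Ω.OrdConnected) {ψ : ℝ → ℝ}
    (hc : ContDiff ℝ ∞ ψ) (hs : HasCompactSupport ψ) (ht : tsupport ψ ⊆ Ω) (h0 : ∫ x, ψ x = 0) :
    ∃ Ψ : ℝ → ℝ, ContDiff ℝ ∞ Ψ ∧ HasCompactSupport Ψ ∧ tsupport Ψ ⊆ Ω ∧ deriv Ψ = ψ := by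
  rcases (tsupport ψ).eq_empty_or_nonempty with he | hne
  · have : ψ = 0 := tsupport_eq_empty_iff.1 he
    subst this
    exact ⟨0, hc, hs, ht, by ext x; simp⟩
  set a := sInf (tsupport ψ)
  set b := sSup (tsupport ψ)
  have haK : a ∈ tsupport ψ := hs.isCompact.sInf_mem hne
  have hbK : b ∈ tsupport ψ := hs.isCompact.sSup_mem hne
  have hK : tsupport ψ ⊆ Set.Icc a b := fun x hx =>
    ⟨csInf_le hs.isCompact.bddBelow hx, le_csSup hs.isCompact.bddAbove hx⟩
  have hab : Set.Icc a b ⊆ Ω := hΩ.out (ht haK) (ht hbK)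
  set Ψ : ℝ → ℝ := fun x => ∫ y in (a - 1)..x, ψ y with hΨ
  have hd : ∀ x, HasDerivAt Ψ (ψ x) x := fun x =>
    intervalIntegral.integral_hasDerivAt_right (hc.continuous.intervalIntegrable _ _)
      (hc.continuous.stronglyMeasurableAtFilter _ _) hc.continuous.continuousAt
  have hderiv : deriv Ψ = ψ := funext fun x => (hd x).deriv
  have hsupp : Function.support Ψ ⊆ Set.Icc a b := by
    intro x hx
    by_contra hx'
    apply hx
    rw [Set.mem_Icc, not_and_or, not_le, not_le] at hx'
    rcases hx' with h | h
    · have : ∀ y ∈ Set.uIcc (a - 1) x, ψ y = 0 := by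
        intro y hy
        refine image_eq_zero_of_notMem_tsupport fun hy' => ?_
        have h1 := (hK hy').1
        have h2 : y ≤ max (a - 1) x := hy.2
        have h3 : max (a - 1) x < a := max_lt (by linarith) h
        linarith
      simp only [hΨ]
      rw [intervalIntegral.integral_congr this]
      simp
    · simp only [hΨ]
      rw [intervalIntegral.integral_eq_integral_of_support_subset, h0]
      intro y hy
      have := hK (subset_tsupport _ hy)
      exact ⟨by linarith [this.1], by linarith [this.2]⟩
  have htsupp : tsupport Ψ ⊆ Set.Icc a b := closure_minimal hsupp isClosed_Icc
  have hsmooth : ContDiff ℝ ∞ Ψ := by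
    rw [contDiff_infty_iff_deriv, hderiv]
    exact ⟨fun x => (hd x).differentiableAt, hc⟩
  exact ⟨Ψ, hsmooth, isCompact_Icc.of_isClosed_subset (isClosed_tsupport _) htsupp,
    htsupp.trans hab, hderiv⟩

theorem setIntegral_mul_eq_integral_of_tsupport_subset {Ω : Set ℝ} {ψ : ℝ → ℝ}
    (ht : tsupport ψ ⊆ Ω)
    (h : ℝ → ℝ) : ∫ x in Ω, h x * ψ x = ∫ x, h x * ψ x :=
  setIntegral_eq_integral_of_forall_compl_eq_zero fun x hx => by
    rw [image_eq_zero_of_notMem_tsupport fun hx' => hx (ht hx'), mul_zero]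

theorem integrable_mul_of_hasCompactSupport {h ψ : ℝ → ℝ} (hloc : LocallyIntegrable h volume)
    (hψ : Continuous ψ) (hs : HasCompactSupport ψ) : Integrable (fun x => h x * ψ x) volume := by
  refine (hloc.integrable_smul_left_of_hasCompactSupport hψ hs).congr
    (Eventually.of_forall fun x => ?_)
  simp [mul_comm]

/-- The lemma of du Bois-Reymond: on an interval, a function with zero weak derivative
is constant. -/
theorem exists_ae_eq_const {Ω : Opens ℝ} (hΩ : (Ω : Set ℝ).OrdConnected) {h : ℝ → ℝ}
    (hloc : LocallyIntegrable h volume)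
    (H : ∀ φ : ℝ → ℝ, ContDiff ℝ ∞ φ → HasCompactSupport φ → tsupport φ ⊆ (Ω : Set ℝ) →
      ∫ x, h x * deriv φ x = 0) :
    ∃ c : ℝ, ∀ᵐ x, x ∈ Ω → h x = c := by
  rcases (Ω : Set ℝ).eq_empty_or_nonempty with he | ⟨x₀, hx₀⟩
  · refine ⟨0, Eventually.of_forall fun x hx => ?_⟩
    have : x ∈ (Ω : Set ℝ) := hx
    simp [he] at this
  obtain ⟨r, hr, hball⟩ := Metric.nhds_basis_closedBall.mem_iff.1 (Ω.isOpen.mem_nhds hx₀)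
  let b : ContDiffBump x₀ := ⟨r / 2, r, by positivity, by linarith⟩
  set φ₀ : ℝ → ℝ := b.normed volume with hφ₀
  have hφc : ContDiff ℝ ∞ φ₀ := b.contDiff_normed
  have hφs : HasCompactSupport φ₀ := b.hasCompactSupport_normed
  have hφt : tsupport φ₀ ⊆ (Ω : Set ℝ) := by
    rw [hφ₀, b.tsupport_normed_eq]; exact hball
  have hφi : ∫ x, φ₀ x = 1 := b.integral_normed
  set c := ∫ x, h x * φ₀ x with hc
  refine ⟨c, ?_⟩
  have hz := Ω.isOpen.ae_eq_zero_of_integral_contDiff_smul_eq_zero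
    (f := fun x => h x - c) (μ := volume)
    ((hloc.sub (locallyIntegrable_const c)).locallyIntegrableOn _) (by
      intro g hg hgs hgt
      -- `g - I φ₀` has integral zero, so it is the derivative of a test function.
      set I := ∫ x, g x
      have hgi : Integrable g := hg.continuous.integrable_of_hasCompactSupport hgs
      obtain ⟨Ψ, h1, h2, h3, h4⟩ := exists_test_primitive hΩ (ψ := fun x => g x - I * φ₀ x)
        (hg.sub (contDiff_const.mul hφc)) (hgs.sub hφs.mul_left)
        ((tsupport_sub _ _).trans (Set.union_subset hgt
          ((tsupport_mul_subset_right).trans hφt)))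
        (by
          rw [integral_sub hgi ((hφc.continuous.integrable_of_hasCompactSupport hφs).const_mul I),
            integral_const_mul, hφi]
          ring)
      have h5 := H Ψ h1 h2 h3
      rw [h4] at h5
      have e1 : (fun x => h x * (g x - I * φ₀ x))
          = fun x => h x * g x - I * (h x * φ₀ x) := by ext x; ring
      rw [e1, integral_sub (integrable_mul_of_hasCompactSupport hloc hg.continuous hgs)
        ((integrable_mul_of_hasCompactSupport hloc hφc.continuous hφs).const_mul I),
        integral_const_mul, ← hc] at h5
      have e2 : (fun x => g x • (h x - c)) = fun x => h x * g x - c * g x := by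
        ext x; simp only [smul_eq_mul]; ring
      rw [e2, integral_sub (integrable_mul_of_hasCompactSupport hloc hg.continuous hgs)
        (hgi.const_mul c), integral_const_mul]
      linarith)
  filter_upwards [hz] with x hx hxΩ
  linarith [hx hxΩ]

theorem continuous_primitive {G : ℝ → ℝ} (hG : LocallyIntegrable G volume) (a : ℝ) :
    Continuous fun x => ∫ z in a..x, G z :=
  intervalIntegral.continuous_primitive (fun _ _ => intervalIntegrable_iff.2
    ((hG.integrableOn_isCompact isCompact_uIcc).mono_set Set.uIoc_subset_uIcc)) a

/-- Integration by parts: the primitive of a locally integrable function has that function as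
its weak derivative. -/
theorem integral_primitive_mul_deriv {G : ℝ → ℝ} (hG : LocallyIntegrable G volume) (a : ℝ)
    {φ : ℝ → ℝ} (hc : ContDiff ℝ ∞ φ) (hs : HasCompactSupport φ) :
    ∫ x, (∫ z in a..x, G z) * deriv φ x = - ∫ x, G x * φ x := by
  have hGi : ∀ x y, IntervalIntegrable G volume x y := fun _ _ => intervalIntegrable_iff.2
    ((hG.integrableOn_isCompact isCompact_uIcc).mono_set Set.uIoc_subset_uIcc)
  obtain ⟨R, hR, hsub⟩ : ∃ R > |a|, tsupport φ ⊆ Set.Ioo (-R) R := by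
    obtain ⟨R, hR⟩ := hs.isCompact.isBounded.subset_ball 0
    refine ⟨max R (|a| + 1), lt_max_of_lt_right (by linarith), hR.trans ?_⟩
    rw [Real.ball_eq_Ioo]
    refine Set.Ioo_subset_Ioo ?_ ?_
    · rw [zero_sub]; exact neg_le_neg (le_max_left _ _)
    · rw [zero_add]; exact le_max_left _ _
  have hR0 : 0 < R := lt_of_le_of_lt (abs_nonneg a) hR
  have hzero : ∀ x, x ∉ Set.Ioo (-R) R → φ x = 0 := fun x hx =>
    image_eq_zero_of_notMem_tsupport fun h => hx (hsub h)
  have e : ∀ {ψ : ℝ → ℝ} (k : ℝ → ℝ), tsupport ψ ⊆ Set.Ioo (-R) R →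
      ∫ x, k x * ψ x = ∫ x in (-R)..R, k x * ψ x := by
    intro ψ k hψ
    rw [intervalIntegral.integral_eq_integral_of_support_subset]
    intro x hx
    have := hψ (subset_tsupport _ (Function.support_mul_subset_right _ _ hx))
    exact ⟨this.1, this.2.le⟩
  rw [e _ ((tsupport_deriv_subset (f := φ)).trans hsub), e G hsub]
  have haI : a ∈ Set.uIcc (-R) R := by
    rw [Set.uIcc_of_le (by linarith)]
    exact ⟨by linarith [neg_abs_le a], by linarith [le_abs_self a]⟩
  have h1 := (hGi (-R) R).absolutelyContinuousOnInterval_intervalIntegral haI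
  have h2 : AbsolutelyContinuousOnInterval φ (-R) R :=
    (hc.of_le (by simp)).contDiffOn.absolutelyContinuousOnInterval
  rw [h1.integral_mul_deriv_eq_deriv_mul h2, hzero R (by simp), hzero (-R) (by simp)]
  have h3 : ∫ x in (-R)..R, deriv (fun x => ∫ z in a..x, G z) x * φ x
      = ∫ x in (-R)..R, G x * φ x := by
    refine intervalIntegral.integral_congr_ae ?_
    filter_upwards [LocallyIntegrable.ae_hasDerivAt_integral hG] with x hx _
    rw [(hx a).deriv]
  rw [h3]
  ring

/-- The boundary values of a function that is a.e. a primitive are those of the primitive. -/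
theorem hasValueAt_iff_of_ae_eq_primitive {p : ℝ≥0∞} {Ω : Opens ℝ} {f : LpOn p Ω} {c : ℝ}
    {G : ℝ → ℝ} (hG : LocallyIntegrable G volume)
    (h : ∀ᵐ x, x ∈ Ω → f x = c + ∫ z in (0 : ℝ)..x, G z)
    {a v : ℝ} (ha : a ∈ closure (Ω : Set ℝ)) :
    HasValueAt f a v ↔ v = c + ∫ z in (0 : ℝ)..a, G z := by
  have hcont : Continuous fun x => c + ∫ z in (0 : ℝ)..x, G z :=
    continuous_const.add (continuous_primitive hG 0)
  have hrep := (ae_restrict_iff' Ω.isOpen.measurableSet).2 h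
  constructor
  · rintro ⟨F, hF, he, rfl⟩
    have hopen : Set.EqOn F (fun x => c + ∫ z in (0 : ℝ)..x, G z) (Ω : Set ℝ) :=
      Measure.eqOn_open_of_ae_eq (μ := volume) (he.symm.trans hrep) Ω.isOpen
        (hF.mono subset_closure) hcont.continuousOn
    exact hopen.of_subset_closure hF hcont.continuousOn subset_closure subset_rfl ha
  · rintro rfl
    exact ⟨_, hcont.continuousOn, hrep, rfl⟩

variable {p : ℝ≥0∞} [Fact (1 ≤ p)]

/-- An element of `W^{1,p}` of an interval is a.e. the primitive of its weak derivative. -/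
theorem HasWeakDeriv.exists_ae_eq_primitive {Ω : Opens ℝ} (hΩ : (Ω : Set ℝ).OrdConnected)
    {f g : LpOn p Ω} (h : HasWeakDeriv f g) :
    ∃ c : ℝ, ∀ᵐ x, x ∈ Ω → f x = c + ∫ z in (0 : ℝ)..x, zeroExt Ω g z := by
  have hG := locallyIntegrable_lp (zeroExt Ω g)
  have hF := locallyIntegrable_lp (zeroExt Ω f)
  have hP := (continuous_primitive hG 0).locallyIntegrable (μ := volume)
  have hE : ∀ (k : LpOn p Ω) {ψ : ℝ → ℝ}, tsupport ψ ⊆ (Ω : Set ℝ) →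
      ∫ x, zeroExt Ω k x * ψ x = ∫ x in (Ω : Set ℝ), k x * ψ x := by
    intro k ψ ht
    rw [← setIntegral_mul_eq_integral_of_tsupport_subset ht]
    refine setIntegral_congr_ae Ω.isOpen.measurableSet ?_
    filter_upwards [zeroExt_ae Ω k] with x hx hxΩ
    rw [hx, Set.indicator_of_mem hxΩ]
  obtain ⟨c, hc⟩ := exists_ae_eq_const hΩ
    (h := fun x => zeroExt Ω f x - ∫ z in (0 : ℝ)..x, zeroExt Ω g z) (hF.sub hP) (by
      intro φ hφ hφs hφt
      have hd : Continuous (deriv φ) := hφ.continuous_deriv (by simp)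
      simp only [sub_mul]
      rw [integral_sub (integrable_mul_of_hasCompactSupport hF hd hφs.deriv)
        (integrable_mul_of_hasCompactSupport hP hd hφs.deriv),
        integral_primitive_mul_deriv hG 0 hφ hφs,
        hE f ((tsupport_deriv_subset (f := φ)).trans hφt), hE g hφt, h φ hφ hφs hφt]
      ring)
  refine ⟨c, ?_⟩
  filter_upwards [hc, zeroExt_ae Ω f] with x hx h1 hxΩ
  rw [Set.indicator_of_mem hxΩ] at h1
  rw [← hx hxΩ, h1]
  ring

end Sobolev

/-! ### Difference quotients of translates -/

section Quotients

variable {p : ℝ≥0∞} [Fact (1 ≤ p)]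

theorem tendsto_coe_nhdsGT_zero : Tendsto (fun t : ℝ≥0 => (t : ℝ)) (𝓝[>] 0) (𝓝[>] 0) := by
  refine tendsto_nhdsWithin_iff.2 ⟨?_, ?_⟩
  · exact (NNReal.continuous_coe.tendsto 0).mono_left nhdsWithin_le_nhds
  · filter_upwards [self_mem_nhdsWithin] with t ht
    exact_mod_cast ht

theorem restr_shift_ae (Ω : Opens ℝ) (c : ℝ) (F : Lp ℝ p (volume : Measure ℝ)) :
    ∀ᵐ x, x ∈ Ω → restr Ω (shift c F) x = F (x - c) := by
  filter_upwards [restr_ae Ω (shift c F), shift_ae c F] with x h1 h2 hx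
  rw [h1 hx, h2]

theorem LpOn.eq_zero_of_pairing {Ω : Opens ℝ} {d : LpOn p Ω}
    (h : ∀ φ : ℝ → ℝ, ContDiff ℝ ∞ φ → HasCompactSupport φ → tsupport φ ⊆ (Ω : Set ℝ) →
      ∫ x in (Ω : Set ℝ), d x * φ x = 0) : d = 0 := by
  refine HasWeakDeriv.unique (f := (0 : LpOn p Ω)) (fun φ hc hs ht => ?_) HasWeakDeriv.zero
  have h0 := (HasWeakDeriv.zero : HasWeakDeriv (0 : LpOn p Ω) 0) φ hc hs ht
  rw [h φ hc hs ht, h0, neg_zero, neg_eq_zero]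
  refine integral_eq_zero_of_ae ?_
  filter_upwards [Lp.coeFn_zero ℝ p (volume.restrict (Ω : Set ℝ))] with x hx
  rw [hx]
  simp

/-- If the difference quotients of translates of `F` converge in `L^p(Ω)`, the limit is, up to the
sign given by the direction of translation, the weak derivative of `F` on `Ω`: in a pairing with
a test function the translation can be moved to the test function. -/
theorem hasWeakDeriv_of_tendsto {Ω : Opens ℝ} {ε : ℝ} (hε : ε * ε = 1)
    {F : Lp ℝ p (volume : Measure ℝ)} {g : LpOn p Ω}
    (h : Tendsto (fun t : ℝ≥0 => (t : ℝ)⁻¹ • (restr Ω (shift (ε * t) F) - restr Ω F))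
      (𝓝[>] 0) (𝓝 g)) :
    HasWeakDeriv (restr Ω F) (-ε • g) := by
  intro φ hc hs ht
  have hloc := locallyIntegrable_lp F
  obtain ⟨L, hL⟩ := exists_pairing (p := p) Ω hc.continuous hs
  set k : ℝ → ℝ := fun s => ∫ y, F y * φ (y + s) with hk
  have hLs : ∀ s, L (restr Ω (shift s F)) = k s := by
    intro s
    rw [hL]
    have e1 : ∫ x in (Ω : Set ℝ), restr Ω (shift s F) x * φ x
        = ∫ x in (Ω : Set ℝ), F (x - s) * φ x := by
      refine setIntegral_congr_ae Ω.isOpen.measurableSet ?_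
      filter_upwards [restr_shift_ae Ω s F] with x hx hxΩ
      rw [hx hxΩ]
    rw [e1, setIntegral_mul_eq_integral_of_tsupport_subset ht (fun x => F (x - s))]
    simp only [hk]
    rw [← integral_sub_right_eq_self (fun y => F y * φ (y + s)) s]
    simp
  -- `k` is the convolution of `F` with the reflected test function, up to a reflection.
  have hkd : HasDerivAt k (∫ y, F y * deriv φ y) 0 := by
    set ψ : ℝ → ℝ := fun z => φ (-z) with hψ
    have hψs : HasCompactSupport ψ := hs.comp_homeomorph (Homeomorph.neg ℝ)
    have hψc : ContDiff ℝ 1 ψ := (hc.of_le (by simp)).comp contDiff_neg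
    have h1 := hψs.hasDerivAt_convolution_right (ContinuousLinearMap.mul ℝ ℝ) (μ := volume)
      hloc hψc (-0 : ℝ)
    have h2 := h1.scomp (0 : ℝ) (hasDerivAt_neg (0 : ℝ))
    have e1 : (convolution (F : ℝ → ℝ) ψ (ContinuousLinearMap.mul ℝ ℝ) volume)
        ∘ (fun x : ℝ => -x) = k := by
      ext s
      simp only [Function.comp, convolution, hk, hψ, ContinuousLinearMap.mul_apply']
      refine integral_congr_ae (Eventually.of_forall fun y => ?_)
      simp only
      congr 2
      ring
    have e2 : (-1 : ℝ) • (convolution (F : ℝ → ℝ) (deriv ψ) (ContinuousLinearMap.mul ℝ ℝ) volume)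
        (-0 : ℝ) = ∫ y, F y * deriv φ y := by
      simp only [convolution, ContinuousLinearMap.mul_apply']
      rw [smul_eq_mul, ← integral_const_mul]
      refine integral_congr_ae (Eventually.of_forall fun y => ?_)
      simp only [hψ]
      rw [deriv_comp_neg]
      simp
    have h3 := h2
    rw [e2] at h3
    exact e1 ▸ h3
  have hq : Tendsto (fun t : ℝ≥0 => L ((t : ℝ)⁻¹ • (restr Ω (shift (ε * t) F) - restr Ω F)))
      (𝓝[>] 0) (𝓝 (ε * ∫ y, F y * deriv φ y)) := by
    have hkε : HasDerivAt (fun t => k (ε * t)) (ε * ∫ y, F y * deriv φ y) 0 := by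
      have h1 : HasDerivAt (fun t : ℝ => ε * t) ε 0 := by
        simpa using (hasDerivAt_id (0 : ℝ)).const_mul ε
      have h2 : HasDerivAt k (∫ y, F y * deriv φ y) (ε * 0) := by simpa using hkd
      simpa [Function.comp_def] using h2.scomp (0 : ℝ) h1
    refine (hkε.tendsto_slope_zero_right.comp tendsto_coe_nhdsGT_zero).congr fun t => ?_
    have h0 : L (restr Ω F) = k 0 := by rw [← hLs, shift_zero]
    simp only [Function.comp, map_smul, map_sub, hLs, h0, zero_add, mul_zero]
  have hlim := tendsto_nhds_unique ((L.continuous.tendsto g).comp h) hq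
  have h1 : ∫ x in (Ω : Set ℝ), restr Ω F x * deriv φ x = ∫ y, F y * deriv φ y := by
    rw [← setIntegral_mul_eq_integral_of_tsupport_subset
      ((tsupport_deriv_subset (f := φ)).trans ht)]
    refine setIntegral_congr_ae Ω.isOpen.measurableSet ?_
    filter_upwards [restr_ae Ω F] with x hx hxΩ
    rw [hx hxΩ]
  rw [h1, ← hL, map_smul, hlim, smul_eq_mul, ← mul_assoc, neg_mul, hε]
  ring

/-- If the increments of `F` are integrals of `H`, the difference quotients of translates of `F`
are averages over short times of translates of `H`, and so converge to `H` up to sign. -/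
theorem tendsto_of_increment (hp : p ≠ ⊤) {Ω : Opens ℝ} {ε : ℝ}
    {F H : Lp ℝ p (volume : Measure ℝ)}
    (h : ∀ t : ℝ, 0 < t → t < 1 → ∀ᵐ x, x ∈ Ω →
      F (x - ε * t) - F x = ∫ z in x..(x - ε * t), H z) :
    Tendsto (fun t : ℝ≥0 => (t : ℝ)⁻¹ • (restr Ω (shift (ε * t) F) - restr Ω F))
      (𝓝[>] 0) (𝓝 (-ε • restr Ω H)) := by
  have hcont : Continuous fun s : ℝ => restr Ω (shift (ε * s) H) :=
    (restr Ω).continuous.comp ((continuous_shift hp H).comp (continuous_const.mul continuous_id))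
  set I : ℝ → LpOn p Ω := fun t => -ε • ∫ s in (0 : ℝ)..t, restr Ω (shift (ε * s) H) with hI
  have hId : HasDerivAt I (-ε • restr Ω H) 0 := by
    have := intervalIntegral.integral_hasDerivAt_right (hcont.intervalIntegrable 0 0)
      (hcont.stronglyMeasurableAtFilter volume (𝓝 0)) hcont.continuousAt
    simp only [mul_zero, shift_zero] at this
    exact this.const_smul (-ε)
  have hIeq : ∀ t : ℝ, 0 < t → t < 1 → I t = restr Ω (shift (ε * t) F) - restr Ω F := by
    intro t ht0 ht1
    rw [← sub_eq_zero]
    refine LpOn.eq_zero_of_pairing fun φ hc hs _ => ?_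
    obtain ⟨L, hL⟩ := exists_pairing (p := p) Ω hc.continuous hs
    obtain ⟨L', hL'⟩ := exists_pairing (p := p) Ω hc.continuous.norm hs.norm
    rw [← hL, map_sub, sub_eq_zero, hI]
    simp only
    rw [map_smul, ← ContinuousLinearMap.intervalIntegral_comp_comm L (hcont.intervalIntegrable 0 t)]
    have e1 : ∀ s, L (restr Ω (shift (ε * s) H)) = ∫ x in (Ω : Set ℝ), H (x - ε * s) * φ x := by
      intro s
      rw [hL]
      refine setIntegral_congr_ae Ω.isOpen.measurableSet ?_
      filter_upwards [restr_shift_ae Ω (ε * s) H] with x hx hxΩ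
      rw [hx hxΩ]
    simp only [e1]
    have hH : StronglyMeasurable (H : ℝ → ℝ) := Lp.stronglyMeasurable H
    have hmeas : StronglyMeasurable
        (Function.uncurry fun s x : ℝ => H (x - ε * s) * φ x) := by
      refine StronglyMeasurable.mul (hH.comp_measurable ?_)
        (hc.continuous.stronglyMeasurable.comp_measurable measurable_snd)
      fun_prop
    rw [intervalIntegral_integral_swap, hL, smul_eq_mul, ← integral_const_mul]
    · refine setIntegral_congr_ae Ω.isOpen.measurableSet ?_
      have hsub := (ae_restrict_iff' Ω.isOpen.measurableSet).1
        (Lp.coeFn_sub (restr Ω (shift (ε * t) F)) (restr Ω F))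
      filter_upwards [h t ht0 ht1, hsub, restr_shift_ae Ω (ε * t) F, restr_ae Ω F]
        with x h1 h2 h3 h4 hx
      have hsubst := intervalIntegral.mul_integral_comp_sub_mul (a := 0) (b := t)
        (f := fun z => H z) ε x
      rw [mul_zero, sub_zero] at hsubst
      rw [h2 hx, Pi.sub_apply, h3 hx, h4 hx, h1 hx, intervalIntegral.integral_mul_const,
        ← mul_assoc, neg_mul, hsubst, intervalIntegral.integral_symm x, neg_neg]
    · rw [integrable_prod_iff hmeas.aestronglyMeasurable]
      have hn : ∀ s, ∫ x in (Ω : Set ℝ), ‖H (x - ε * s) * φ x‖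
          = L' |restr Ω (shift (ε * s) H)| := by
        intro s
        rw [hL']
        refine setIntegral_congr_ae Ω.isOpen.measurableSet ?_
        have habs := (ae_restrict_iff' Ω.isOpen.measurableSet).1
          (Lp.coeFn_abs (restr Ω (shift (ε * s) H)))
        filter_upwards [restr_shift_ae Ω (ε * s) H, habs] with x h1 h2 hx
        rw [h2 hx, h1 hx, norm_mul, Real.norm_eq_abs]
      refine ⟨Eventually.of_forall fun s => ?_, ?_⟩
      · refine (integrable_mul_test (restr Ω (shift (ε * s) H)) hc.continuous hs).congr ?_
        refine (ae_restrict_iff' Ω.isOpen.measurableSet).2 ?_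
        filter_upwards [restr_shift_ae Ω (ε * s) H] with x h1 hx
        rw [h1 hx]
        rfl
      · refine Measure.integrableOn_of_bounded (M := ‖L'‖ * (‖restr (p := p) Ω‖ * ‖H‖)) (by simp)
          ?_ (Eventually.of_forall fun s => ?_)
        · exact (hmeas.norm.integral_prod_right
            (ν := volume.restrict (Ω : Set ℝ))).aestronglyMeasurable
        · simp only [Function.uncurry]
          rw [hn s]
          refine (L'.le_opNorm _).trans ?_
          rw [norm_abs_eq_norm]
          refine mul_le_mul_of_nonneg_left ?_ (norm_nonneg _)
          refine ((restr Ω).le_opNorm _).trans ?_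
          rw [norm_shift]
  refine (hId.tendsto_slope_zero_right.comp tendsto_coe_nhdsGT_zero).congr' ?_
  have hlt : ∀ᶠ t : ℝ≥0 in 𝓝[>] 0, t < 1 :=
    nhdsWithin_le_nhds (Iio_mem_nhds zero_lt_one)
  filter_upwards [self_mem_nhdsWithin, hlt] with t ht0 ht1
  have h0 : I 0 = 0 := by simp [hI]
  simp only [Function.comp, zero_add, h0, sub_zero]
  rw [hIeq t (by exact_mod_cast ht0) (by exact_mod_cast ht1)]

end Quotients

/-! ### Matching of boundary values -/

section Boundary

variable {p : ℝ≥0∞}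

/-- The indicator function of `(-1, 0)`. -/
noncomputable def leftIndicator : Lp ℝ p (volume : Measure ℝ) :=
  indicatorConstLp p (measurableSet_Ioo : MeasurableSet (Set.Ioo (-1 : ℝ) 0)) (by simp) 1

theorem leftIndicator_ae :
    ∀ᵐ x, (leftIndicator : Lp ℝ p (volume : Measure ℝ)) x = (Set.Ioo (-1 : ℝ) 0).indicator 1 x := by
  have h := indicatorConstLp_coeFn (p := p) (μ := (volume : Measure ℝ))
    (hs := (measurableSet_Ioo : MeasurableSet (Set.Ioo (-1 : ℝ) 0))) (hμs := by simp) (c := (1 : ℝ))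
  exact h

variable [Fact (1 ≤ p)]

/-- The difference quotients converge if `F` is a primitive of `H` on a set `S` which contains `Ω`
and, up to the point `0`, the translates of `Ω` by short times. -/
theorem tendsto_of_ae_eq_primitive (hp : p ≠ ⊤) {Ω : Opens ℝ} {ε c : ℝ}
    {F H : Lp ℝ p (volume : Measure ℝ)} {S : Set ℝ}
    (hS : ∀ᵐ x, x ∈ S → F x = c + ∫ z in (0 : ℝ)..x, H z) (hΩS : ∀ x ∈ Ω, x ∈ S)
    (hshift : ∀ t : ℝ, 0 < t → t < 1 → ∀ x ∈ Ω, x - ε * t ≠ 0 → x - ε * t ∈ S) :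
    Tendsto (fun t : ℝ≥0 => (t : ℝ)⁻¹ • (restr Ω (shift (ε * t) F) - restr Ω F))
      (𝓝[>] 0) (𝓝 (-ε • restr Ω H)) := by
  refine tendsto_of_increment hp fun t ht0 ht1 => ?_
  filter_upwards [hS, ae_comp_sub (ε * t) hS, ae_comp_sub (ε * t) (Measure.ae_ne volume 0)]
    with x h1 h2 h3 hx
  rw [h1 (hΩS x hx), h2 (hshift t ht0 ht1 x hx h3),
    ← intervalIntegral.integral_interval_sub_left (intervalIntegrable_lp H 0 (x - ε * t))
      (intervalIntegrable_lp H 0 x)]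
  ring

/-- `Ω` is an interval with left end point `0`. -/
def StartsAtZero (Ω : Opens ℝ) : Prop :=
  (Ω : Set ℝ).Nonempty ∧ ∀ x ∈ Ω, 0 < x ∧ Set.Ioc 0 x ⊆ (Ω : Set ℝ)

/-- A jump at `0` prevents convergence of the difference quotients: their integrals near `0`
tend to the height of the jump, not to `0`. -/
theorem not_tendsto_leftIndicator {Ω : Opens ℝ} (hΩ : StartsAtZero Ω) :
    ¬ Tendsto (fun t : ℝ≥0 => (t : ℝ)⁻¹ • (restr Ω (shift (1 * t) leftIndicator)
      - restr Ω leftIndicator)) (𝓝[>] 0) (𝓝 (0 : LpOn p Ω)) := by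
  intro h
  let b : ContDiffBump (0 : ℝ) := ⟨1, 2, one_pos, one_lt_two⟩
  obtain ⟨L, hL⟩ := exists_pairing (p := p) Ω b.continuous b.hasCompactSupport
  obtain ⟨⟨x₀, hx₀⟩, hpos⟩ := hΩ
  have hx₀pos := (hpos x₀ hx₀).1
  have hval : ∀ t : ℝ≥0, 0 < t → t < 1 → (t : ℝ) ≤ x₀ →
      L ((t : ℝ)⁻¹ • (restr Ω (shift (1 * t) leftIndicator) - restr Ω leftIndicator)) = 1 := by
    intro t ht0 ht1 htx
    have ht0' : (0 : ℝ) < t := by exact_mod_cast ht0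
    have ht1' : (t : ℝ) < 1 := by exact_mod_cast ht1
    have e : ∫ x in (Ω : Set ℝ), (restr Ω (shift (1 * t) leftIndicator) - restr Ω leftIndicator :
        LpOn p Ω) x * b x = ∫ x in (Ω : Set ℝ), (Set.Ioo (0 : ℝ) t).indicator 1 x := by
      refine setIntegral_congr_ae Ω.isOpen.measurableSet ?_
      have hsub := (ae_restrict_iff' Ω.isOpen.measurableSet).1
        (Lp.coeFn_sub (restr Ω (shift (1 * (t : ℝ)) (leftIndicator (p := p))))
          (restr Ω leftIndicator))
      filter_upwards [hsub, restr_shift_ae Ω (1 * (t : ℝ)) (leftIndicator (p := p)),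
        restr_ae Ω (leftIndicator (p := p)), leftIndicator_ae (p := p),
        ae_comp_sub (1 * (t : ℝ)) (leftIndicator_ae (p := p))] with x h1 h2 h3 h4 h5 hx
      have hx0 := (hpos x hx).1
      rw [h1 hx, Pi.sub_apply, h2 hx, h3 hx, h4, h5,
        Set.indicator_of_notMem (a := x) (s := Set.Ioo (-1 : ℝ) 0)
          (fun h => absurd h.2 (not_lt.2 hx0.le)), sub_zero]
      by_cases hxt : x < t
      · rw [Set.indicator_of_mem (show x ∈ Set.Ioo (0 : ℝ) t from ⟨hx0, hxt⟩),
          Set.indicator_of_mem (show x - 1 * t ∈ Set.Ioo (-1 : ℝ) 0 from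
            ⟨by linarith, by linarith⟩), b.one_of_mem_closedBall]
        · simp
        · rw [Metric.mem_closedBall, Real.dist_eq, sub_zero, abs_of_pos hx0]
          change x ≤ 1
          linarith
      · rw [Set.indicator_of_notMem (fun h : x ∈ Set.Ioo (0 : ℝ) t => hxt h.2),
          Set.indicator_of_notMem (fun h : x - 1 * t ∈ Set.Ioo (-1 : ℝ) 0 => by
            have := h.2; apply hxt; linarith), zero_mul]
    have hss : Set.Ioo (0 : ℝ) t ⊆ (Ω : Set ℝ) := fun y hy =>
      (hpos x₀ hx₀).2 ⟨hy.1, hy.2.le.trans htx⟩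
    rw [map_smul, hL, e, setIntegral_indicator measurableSet_Ioo,
      Set.inter_eq_self_of_subset_right hss]
    simp [ht0'.ne']
  have h1 : Tendsto (fun _ : ℝ≥0 => (1 : ℝ)) (𝓝[>] 0) (𝓝 (L 0)) := by
    refine ((L.continuous.tendsto 0).comp h).congr' ?_
    have hlt : ∀ᶠ t : ℝ≥0 in 𝓝[>] 0, t < 1 :=
      nhdsWithin_le_nhds (Iio_mem_nhds zero_lt_one)
    have hlx : ∀ᶠ t : ℝ≥0 in 𝓝[>] 0, (t : ℝ) < x₀ :=
      nhdsWithin_le_nhds (NNReal.continuous_coe.continuousAt.eventually_lt continuousAt_const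
        (by simpa using hx₀pos))
    filter_upwards [self_mem_nhdsWithin, hlt, hlx] with t ht0 ht1 htx
    exact hval t ht0 ht1 htx.le
  have := tendsto_nhds_unique h1 tendsto_const_nhds
  simp at this

/-- For a function that is a primitive of `H` on both sides of `0`, the difference quotients of the
translates to the right converge in `L^p(Ω)` exactly if the one-sided values at `0` agree. -/
theorem tendsto_iff_of_ae_eq_primitive (hp : p ≠ ⊤) {Ω : Opens ℝ} (hΩ : StartsAtZero Ω) {c d : ℝ}
    {F H : Lp ℝ p (volume : Measure ℝ)}
    (hr : ∀ᵐ x, x ∈ Ω → F x = c + ∫ z in (0 : ℝ)..x, H z)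
    (hl : ∀ᵐ x, x ∈ Set.Ioo (-1 : ℝ) 0 → F x = d + ∫ z in (0 : ℝ)..x, H z) :
    Tendsto (fun t : ℝ≥0 => (t : ℝ)⁻¹ • (restr Ω (shift t F) - restr Ω F))
      (𝓝[>] 0) (𝓝 (-restr Ω H)) ↔ c = d := by
  set F' := F - (d - c) • leftIndicator with hF'
  have hF'conv : Tendsto (fun t : ℝ≥0 => (t : ℝ)⁻¹ • (restr Ω (shift (1 * t) F') - restr Ω F'))
      (𝓝[>] 0) (𝓝 (-(1 : ℝ) • restr Ω H)) := by
    refine tendsto_of_ae_eq_primitive hp (c := c) (S := Set.Ioo (-1) 0 ∪ Ω) ?_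
      (fun x hx => Or.inr hx) ?_
    · filter_upwards [hr, hl, Lp.coeFn_sub F ((d - c) • leftIndicator (p := p)),
        Lp.coeFn_smul (d - c) (leftIndicator (p := p)), leftIndicator_ae (p := p)]
        with x h1 h2 h3 h4 h5 hx
      rw [hF', h3, Pi.sub_apply, h4, Pi.smul_apply, h5]
      rcases hx with hx | hx
      · rw [h2 hx, Set.indicator_of_mem hx]
        simp only [Pi.one_apply, smul_eq_mul]
        ring
      · rw [h1 hx, Set.indicator_of_notMem fun h =>
          absurd h.2 (not_lt.2 (hΩ.2 x hx).1.le)]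
        simp
    · intro t ht0 ht1 x hx hne
      have hx0 := hΩ.2 x hx
      rcases lt_or_gt_of_ne hne with h | h
      · exact Or.inl ⟨by linarith [hx0.1], h⟩
      · exact Or.inr (hx0.2 ⟨h, by linarith⟩)
  have hquot : ∀ t : ℝ≥0, (t : ℝ)⁻¹ • (restr Ω (shift (1 * t) F') - restr Ω F')
      = (t : ℝ)⁻¹ • (restr Ω (shift t F) - restr Ω F) - (d - c) • ((t : ℝ)⁻¹ •
        (restr Ω (shift (1 * t) leftIndicator) - restr Ω (leftIndicator (p := p)))) := by
    intro t
    simp only [hF', map_sub, map_smul, one_mul]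
    rw [smul_comm (d - c), ← smul_sub]
    congr 1
    rw [smul_sub]
    abel
  simp only [hquot, neg_smul, one_smul] at hF'conv
  constructor
  · intro h
    by_contra hne
    have hdc : d - c ≠ 0 := sub_ne_zero.2 (Ne.symm hne)
    have h1 := (h.sub hF'conv).const_smul (d - c)⁻¹
    simp only [sub_sub_cancel, smul_smul, sub_self, smul_zero] at h1
    refine not_tendsto_leftIndicator (p := p) hΩ (h1.congr fun t => ?_)
    rw [← mul_assoc, inv_mul_cancel₀ hdc, one_mul]
  · rintro rfl
    simpa using hF'conv

end Boundary

/-! ### The transport semigroup -/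

section Transport

variable {p : ℝ≥0∞} [Fact (1 ≤ p)] {m q r : ℕ}

/-- The interval on which the `i`-th component transported to the right is defined. -/
def edge : Fin m ⊕ Fin q → Opens ℝ :=
  Sum.elim (fun _ => unitInterval) (fun _ => halfLine)

/-- The components `(u, v)` of `(u, v, w)`, which are transported to the right. -/
noncomputable def rightComp :
    (i : Fin m ⊕ Fin q) → StateSpace p m q r →L[ℝ] LpOn p (edge i)
  | Sum.inl j =>
    (ContinuousLinearMap.proj (R := ℝ) (φ := fun _ : Fin m => LpOn p unitInterval) j).comp
      (ContinuousLinearMap.fst ℝ _ _)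
  | Sum.inr j =>
    (ContinuousLinearMap.proj (R := ℝ) (φ := fun _ : Fin q => LpOn p halfLine) j).comp
      ((ContinuousLinearMap.fst ℝ _ _).comp (ContinuousLinearMap.snd ℝ _ _))

/-- The components `w` of `(u, v, w)`, which are transported to the left. -/
noncomputable def leftComp (j : Fin r) : StateSpace p m q r →L[ℝ] LpOn p halfLine :=
  (ContinuousLinearMap.proj (R := ℝ) (φ := fun _ : Fin r => LpOn p halfLine) j).comp
    ((ContinuousLinearMap.snd ℝ _ _).comp (ContinuousLinearMap.snd ℝ _ _))

/-- The value at `-t`, for `0 < t < 1`, of `inflow k f` is the value which, in the evolution with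
initial state `f`, the `k`-th entry of `(u(1), w(0))` has at time `t`. -/
noncomputable def inflow (k : Fin m ⊕ Fin r) :
    StateSpace p m q r →L[ℝ] Lp ℝ p (volume : Measure ℝ) :=
  k.elim (fun j => (shift (-1)).comp ((zeroExt unitInterval).comp (rightComp (Sum.inl j))))
    (fun j => reflect.comp ((zeroExt halfLine).comp (leftComp j)))

/-- The prolongation of the `i`-th component of `(u, v)` to the left of `0` by the values which
the boundary condition sends into the edge during the time interval `(0, 1)`. -/
noncomputable def prolong (B : Matrix (Fin m ⊕ Fin q) (Fin m ⊕ Fin r) ℝ) (i : Fin m ⊕ Fin q) :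
    StateSpace p m q r →L[ℝ] Lp ℝ p (volume : Measure ℝ) :=
  (zeroExt (edge i)).comp (rightComp i) + ∑ k, B i k • inflow k

/-- The evolution during a time `t ≤ 1`: translate the prolonged functions. -/
noncomputable def evolve (B : Matrix (Fin m ⊕ Fin q) (Fin m ⊕ Fin r) ℝ) (t : ℝ) :
    StateSpace p m q r →L[ℝ] StateSpace p m q r :=
  (ContinuousLinearMap.pi fun j =>
      (restr unitInterval).comp ((shift t).comp (prolong B (Sum.inl j)))).prod
    ((ContinuousLinearMap.pi fun j =>
        (restr halfLine).comp ((shift t).comp (prolong B (Sum.inr j)))).prod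
      (ContinuousLinearMap.pi fun j =>
        (restr halfLine).comp ((shift (-t)).comp ((zeroExt halfLine).comp (leftComp j)))))

variable (B : Matrix (Fin m ⊕ Fin q) (Fin m ⊕ Fin r) ℝ)

theorem StateSpace.ext_comp {f g : StateSpace p m q r} (h : ∀ i, rightComp i f = rightComp i g)
    (h' : ∀ j, leftComp j f = leftComp j g) : f = g :=
  Prod.ext (funext fun j => h (Sum.inl j))
    (Prod.ext (funext fun j => h (Sum.inr j)) (funext h'))

theorem tendsto_stateSpace_iff {α : Type*} {l : Filter α} {F : α → StateSpace p m q r}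
    {g : StateSpace p m q r} :
    Tendsto F l (𝓝 g) ↔ (∀ i, Tendsto (fun a => rightComp i (F a)) l (𝓝 (rightComp i g))) ∧
      ∀ j, Tendsto (fun a => leftComp j (F a)) l (𝓝 (leftComp j g)) := by
  constructor
  · exact fun h => ⟨fun i => ((rightComp i).continuous.tendsto g).comp h,
      fun j => ((leftComp j).continuous.tendsto g).comp h⟩
  · rintro ⟨h1, h2⟩
    exact (tendsto_pi_nhds.2 fun j => h1 (Sum.inl j)).prodMk_nhds
      ((tendsto_pi_nhds.2 fun j => h1 (Sum.inr j)).prodMk_nhds (tendsto_pi_nhds.2 h2))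

theorem rightComp_evolve (t : ℝ) (i : Fin m ⊕ Fin q) (f : StateSpace p m q r) :
    rightComp i (evolve B t f) = restr (edge i) (shift t (prolong B i f)) := by
  cases i <;> rfl

theorem leftComp_evolve (t : ℝ) (j : Fin r) (f : StateSpace p m q r) :
    leftComp j (evolve B t f) = restr halfLine (shift (-t) (zeroExt halfLine (leftComp j f))) :=
  rfl

theorem mem_halfLine {x : ℝ} : x ∈ halfLine ↔ 0 < x := Iff.rfl

theorem startsAtZero_edge (i : Fin m ⊕ Fin q) : StartsAtZero (edge i) := by
  rcases i with j | j
  · exact ⟨⟨1 / 2, by norm_num, by norm_num⟩,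
      fun x hx => ⟨hx.1, fun y hy => ⟨hy.1, hy.2.trans_lt hx.2⟩⟩⟩
  · exact ⟨⟨1, (zero_lt_one : (0 : ℝ) < 1)⟩, fun x hx => ⟨hx, fun y hy => hy.1⟩⟩

theorem ordConnected_edge (i : Fin m ⊕ Fin q) : (edge i : Set ℝ).OrdConnected := by
  rcases i with j | j
  · exact Set.ordConnected_Ioo
  · exact Set.ordConnected_Ioi

theorem zeroExt_eq_zero_ae {Ω : Opens ℝ} (hΩ : ∀ x ∈ Ω, 0 < x) (f : LpOn p Ω) :
    ∀ᵐ x, x ≤ 0 → zeroExt Ω f x = 0 := by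
  filter_upwards [zeroExt_ae Ω f] with x hx hx0
  rw [hx, Set.indicator_of_notMem fun h => absurd (hΩ x h) (not_lt.2 hx0)]

theorem inflow_inl_ae (j : Fin m) (f : StateSpace p m q r) :
    ∀ᵐ x, inflow (Sum.inl j) f x = zeroExt unitInterval (rightComp (Sum.inl j) f) (x + 1) := by
  have h := shift_ae (-1) (zeroExt unitInterval (rightComp (Sum.inl j) f))
  simp only [sub_neg_eq_add] at h
  exact h

theorem inflow_inr_ae (j : Fin r) (f : StateSpace p m q r) :
    ∀ᵐ x, inflow (Sum.inr j) f x = zeroExt halfLine (leftComp j f) (-x) :=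
  reflect_ae (zeroExt halfLine (leftComp j f))

theorem inflow_eq_zero_ae (k : Fin m ⊕ Fin r) (f : StateSpace p m q r) :
    ∀ᵐ x, 0 ≤ x → inflow k f x = 0 := by
  rcases k with j | j
  · have h := ae_comp_sub (-1) (zeroExt_ae unitInterval (rightComp (Sum.inl j) f))
    simp only [sub_neg_eq_add] at h
    filter_upwards [inflow_inl_ae j f, h] with x h1 h2 hx
    rw [h1, h2, Set.indicator_of_notMem]
    exact fun h => absurd h.2 (by linarith)
  · filter_upwards [inflow_inr_ae j f,
      ae_comp_neg (zeroExt_eq_zero_ae (fun _ => mem_halfLine.1) (leftComp j f))] with x h1 h2 hx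
    rw [h1, h2 (by linarith)]

theorem prolong_ae (i : Fin m ⊕ Fin q) (f : StateSpace p m q r) :
    ∀ᵐ x, prolong B i f x = zeroExt (edge i) (rightComp i f) x + ∑ k, B i k * inflow k f x := by
  have e : prolong B i f = zeroExt (edge i) (rightComp i f) + ∑ k, B i k • inflow k f := by
    simp [prolong]
  rw [e]
  filter_upwards [Lp.coeFn_add (zeroExt (edge i) (rightComp i f)) (∑ k, B i k • inflow k f),
    Lp_sum_smul_ae Finset.univ (B i) (fun k => inflow k f)] with x h1 h2
  rw [h1, Pi.add_apply, h2]

/-- To the right of `0`, the prolongation of a component is its extension by zero. -/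
theorem prolong_ae_of_pos (i : Fin m ⊕ Fin q) (f : StateSpace p m q r) :
    ∀ᵐ x, 0 < x → prolong B i f x = zeroExt (edge i) (rightComp i f) x := by
  have h := ae_all_iff.2 fun k => inflow_eq_zero_ae k f
  filter_upwards [prolong_ae B i f, h] with x h1 h2 hx
  rw [h1, Finset.sum_eq_zero fun k _ => by rw [h2 k hx.le, mul_zero], add_zero]

theorem prolong_ae_of_neg (i : Fin m ⊕ Fin q) (f : StateSpace p m q r) :
    ∀ᵐ x, x < 0 → prolong B i f x = ∑ k, B i k * inflow k f x := by
  filter_upwards [prolong_ae B i f,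
    zeroExt_eq_zero_ae (fun x hx => ((startsAtZero_edge i).2 x hx).1) (rightComp i f)]
    with x h1 h2 hx
  rw [h1, h2 hx.le, zero_add]

theorem restr_prolong (i : Fin m ⊕ Fin q) (f : StateSpace p m q r) :
    restr (edge i) (prolong B i f) = rightComp i f := by
  refine (restr_congr ?_).trans (restr_zeroExt (edge i) (rightComp i f))
  filter_upwards [prolong_ae_of_pos B i f] with x h1 hx
  rw [h1 ((startsAtZero_edge i).2 x hx).1]

theorem evolve_zero : evolve B 0 = ContinuousLinearMap.id ℝ (StateSpace p m q r) := by
  refine ContinuousLinearMap.ext fun f => ?_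
  refine StateSpace.ext_comp (fun i => ?_) fun j => ?_
  · rw [rightComp_evolve, shift_zero, restr_prolong]; rfl
  · rw [leftComp_evolve, neg_zero, shift_zero, restr_zeroExt]; rfl

/-- Up to time `1`, the inflow in the evolved state is the translated inflow. -/
theorem inflow_evolve_ae {t : ℝ} (ht : 0 ≤ t) (k : Fin m ⊕ Fin r) (f : StateSpace p m q r) :
    ∀ᵐ x, t - 1 < x → x < 0 → inflow k (evolve B t f) x = inflow k f (x - t) := by
  rcases k with j | j
  · have h1 := inflow_inl_ae j (evolve B t f)
    rw [rightComp_evolve] at h1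
    have h2 := ae_comp_sub (-1) (zeroExt_restr_ae unitInterval (shift t (prolong B (Sum.inl j) f)))
    have h3 := ae_comp_sub (-1) (shift_ae t (prolong B (Sum.inl j) f))
    have h4 := ae_comp_sub (-1) (ae_comp_sub t (prolong_ae_of_pos B (Sum.inl j) f))
    have h5 := ae_comp_sub t (inflow_inl_ae j f)
    simp only [sub_neg_eq_add] at h2 h3 h4
    filter_upwards [h1, h2, h3, h4, h5] with x h1 h2 h3 h4 h5 hx1 hx0
    rw [h1]
    refine h2.trans ?_
    rw [Set.indicator_of_mem (show x + 1 ∈ (unitInterval : Set ℝ) from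
      ⟨by linarith, by linarith⟩), h3, h4 (by linarith), h5]
    have : x + 1 - t = x - t + 1 := by ring
    rw [this]
    rfl
  · have h1 := inflow_inr_ae j (evolve B t f)
    rw [leftComp_evolve] at h1
    filter_upwards [h1, ae_comp_neg (zeroExt_restr_ae halfLine
        (shift (-t) (zeroExt halfLine (leftComp j f)))),
      ae_comp_neg (shift_ae (-t) (zeroExt halfLine (leftComp j f))),
      ae_comp_sub t (inflow_inr_ae j f)] with x h1 h2 h3 h4 _ hx0
    rw [h1, h2, Set.indicator_of_mem (show -x ∈ (halfLine : Set ℝ) from by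
      change 0 < -x; linarith), h3, h4]
    congr 1
    ring

/-- The prolongation of the state at time `t` is, up to the time `1 - t` ahead, the translate by `t`
of the prolongation of the initial state. -/
theorem prolong_evolve_ae {t : ℝ} (ht : 0 ≤ t) (i : Fin m ⊕ Fin q) (f : StateSpace p m q r) :
    ∀ᵐ x, x ∈ Set.Ioo (t - 1) 0 ∨ x ∈ edge i →
      prolong B i (evolve B t f) x = prolong B i f (x - t) := by
  have h1 := ae_all_iff.2 fun k => inflow_evolve_ae B ht k f
  have h2 := prolong_ae_of_pos B i (evolve B t f)
  rw [rightComp_evolve] at h2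
  filter_upwards [h1, h2, prolong_ae_of_neg B i (evolve B t f),
    ae_comp_sub t (prolong_ae_of_neg B i f), zeroExt_restr_ae (edge i) (shift t (prolong B i f)),
    shift_ae t (prolong B i f)] with x h1 h2 h3 h4 h5 h6 hx
  rcases hx with hx | hx
  · rw [h3 hx.2, h4 (by linarith [hx.2])]
    exact Finset.sum_congr rfl fun k _ => by rw [h1 k hx.1 hx.2]
  · rw [h2 ((startsAtZero_edge i).2 x hx).1, h5, Set.indicator_of_mem hx, h6]

theorem evolve_add {s t : ℝ} (hs : 0 ≤ s) (ht : 0 ≤ t) (hst : s + t ≤ 1) :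
    evolve B (s + t) = (evolve B s).comp (evolve (p := p) (r := r) B t) := by
  refine ContinuousLinearMap.ext fun f => ?_
  rw [ContinuousLinearMap.comp_apply]
  refine StateSpace.ext_comp (fun i => ?_) fun j => ?_
  · rw [rightComp_evolve, rightComp_evolve, ← shift_shift]
    refine restr_congr ?_
    filter_upwards [shift_ae s (shift t (prolong B i f)),
      ae_comp_sub s (shift_ae t (prolong B i f)),
      shift_ae s (prolong B i (evolve B t f)), ae_comp_sub s (prolong_evolve_ae B ht i f),
      ae_comp_sub s (Measure.ae_ne volume 0)] with x h1 h2 h3 h4 h5 hx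
    rw [h1, h2, h3, h4]
    have hx0 := (startsAtZero_edge i).2 x hx
    rcases lt_or_gt_of_ne h5 with h | h
    · exact Or.inl ⟨by linarith [hx0.1], h⟩
    · exact Or.inr (hx0.2 ⟨h, by linarith⟩)
  · rw [leftComp_evolve, leftComp_evolve, leftComp_evolve, neg_add, ← shift_shift]
    refine restr_congr ?_
    set F := shift (-t) (zeroExt halfLine (leftComp j f))
    filter_upwards [shift_ae (-s) F, shift_ae (-s) (zeroExt halfLine (restr halfLine F)),
      ae_comp_sub (-s) (zeroExt_restr_ae halfLine F)] with x h1 h2 h3 hx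
    rw [h1, h2, h3, Set.indicator_of_mem]
    change 0 < x - -s
    linarith [mem_halfLine.1 hx]

theorem continuous_evolve (hp : p ≠ ⊤) (f : StateSpace p m q r) :
    Continuous fun t : ℝ => evolve B t f := by
  rw [continuous_iff_continuousAt]
  intro t
  refine tendsto_stateSpace_iff.2 ⟨fun i => ?_, fun j => ?_⟩
  · simp only [rightComp_evolve]
    exact ((restr _).continuous.comp (continuous_shift hp _)).continuousAt
  · simp only [leftComp_evolve]
    exact ((restr _).continuous.comp ((continuous_shift hp _).comp continuous_neg)).continuousAt

end Transport

/-! ### The generator -/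

section Generator

variable {p : ℝ≥0∞} [Fact (1 ≤ p)] {m q r : ℕ}
  (B : Matrix (Fin m ⊕ Fin q) (Fin m ⊕ Fin r) ℝ)

/-- `f` has weak derivatives in `L^p`, and `(-u', -v', w')` is equal to `g`. -/
def IsTransportDeriv (f g : StateSpace p m q r) : Prop :=
  (∀ i, HasWeakDeriv (rightComp i f) (rightComp i (-g))) ∧
    ∀ j, HasWeakDeriv (leftComp j f) (leftComp j g)

/-- The graph of the transport operator, described without reference to the choice of the
weak derivative. -/
theorem mem_graph_transportOperator_iff (f g : StateSpace p m q r) :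
    (∃ hf : f ∈ (transportOperator p B).domain, transportOperator p B ⟨f, hf⟩ = g) ↔
      IsTransportDeriv f g ∧ BoundaryCondition B f := by
  constructor
  · rintro ⟨⟨hu, hv, hw, hB⟩, rfl⟩
    refine ⟨⟨?_, fun j => weakDeriv_spec ⟨f.2.2 j, hw j⟩⟩, hB⟩
    rintro (j | j)
    · have h := weakDeriv_spec ⟨f.1 j, hu j⟩
      rw [← neg_neg (weakDeriv p unitInterval _)] at h
      exact h
    · have h := weakDeriv_spec ⟨f.2.1 j, hv j⟩
      rw [← neg_neg (weakDeriv p halfLine _)] at h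
      exact h
  · rintro ⟨⟨h1, h2⟩, hB⟩
    have hu : ∀ j, f.1 j ∈ W1p p unitInterval := fun j => ⟨_, h1 (Sum.inl j)⟩
    have hv : ∀ j, f.2.1 j ∈ W1p p halfLine := fun j => ⟨_, h1 (Sum.inr j)⟩
    have hw : ∀ j, f.2.2 j ∈ W1p p halfLine := fun j => ⟨_, h2 j⟩
    refine ⟨⟨hu, hv, hw, hB⟩, StateSpace.ext_comp ?_ fun j => ?_⟩
    · rintro (j | j)
      · have h := (weakDeriv_spec ⟨f.1 j, hu j⟩).unique (h1 (Sum.inl j))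
        have h' : -weakDeriv p unitInterval ⟨f.1 j, hu j⟩ = g.1 j := by
          rw [h]; exact neg_neg (g.1 j)
        exact h'
      · have h := (weakDeriv_spec ⟨f.2.1 j, hv j⟩).unique (h1 (Sum.inr j))
        have h' : -weakDeriv p halfLine ⟨f.2.1 j, hv j⟩ = g.2.1 j := by
          rw [h]; exact neg_neg (g.2.1 j)
        exact h'
    · exact (weakDeriv_spec ⟨f.2.2 j, hw j⟩).unique (h2 j)

theorem rightComp_quotient (t : ℝ) (i : Fin m ⊕ Fin q) (f : StateSpace p m q r) :
    rightComp i (t⁻¹ • (evolve B t f - f))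
      = t⁻¹ • (restr (edge i) (shift t (prolong B i f)) - restr (edge i) (prolong B i f)) := by
  rw [map_smul, map_sub, rightComp_evolve, restr_prolong]

theorem leftComp_quotient (t : ℝ) (j : Fin r) (f : StateSpace p m q r) :
    leftComp j (t⁻¹ • (evolve B t f - f))
      = t⁻¹ • (restr halfLine (shift (-1 * t) (zeroExt halfLine (leftComp j f)))
        - restr halfLine (zeroExt halfLine (leftComp j f))) := by
  rw [map_smul, map_sub, leftComp_evolve, restr_zeroExt, neg_one_mul]

theorem isTransportDeriv_of_tendsto {f g : StateSpace p m q r}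
    (h : Tendsto (fun t : ℝ≥0 => (t : ℝ)⁻¹ • (evolve B t f - f)) (𝓝[>] 0) (𝓝 g)) :
    IsTransportDeriv f g := by
  obtain ⟨h1, h2⟩ := tendsto_stateSpace_iff.1 h
  refine ⟨fun i => ?_, fun j => ?_⟩
  · have := h1 i
    simp only [rightComp_quotient] at this
    have h3 := hasWeakDeriv_of_tendsto (ε := 1) (by norm_num) (F := prolong B i f)
      (g := rightComp i g) (by simpa only [one_mul] using this)
    rw [restr_prolong, neg_one_smul] at h3
    rwa [map_neg]
  · have := h2 j
    simp only [leftComp_quotient] at this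
    have h3 := hasWeakDeriv_of_tendsto (ε := -1) (by norm_num) this
    rwa [restr_zeroExt, neg_neg, one_smul] at h3

theorem zero_mem_closure_halfLine : (0 : ℝ) ∈ closure (halfLine : Set ℝ) := by
  change (0 : ℝ) ∈ closure (Set.Ioi (0 : ℝ))
  rw [closure_Ioi]
  exact Set.self_mem_Ici

theorem closure_unitInterval : closure (unitInterval : Set ℝ) = Set.Icc 0 1 :=
  closure_Ioo zero_ne_one

theorem zero_mem_closure_edge (i : Fin m ⊕ Fin q) : (0 : ℝ) ∈ closure (edge i : Set ℝ) := by
  rcases i with j | j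
  · exact closure_unitInterval.symm ▸ Set.left_mem_Icc.2 zero_le_one
  · exact zero_mem_closure_halfLine

theorem one_mem_closure_unitInterval : (1 : ℝ) ∈ closure (unitInterval : Set ℝ) :=
  closure_unitInterval.symm ▸ Set.right_mem_Icc.2 zero_le_one

theorem inflow_inl_ae_eq_primitive {f f' : StateSpace p m q r} {j : Fin m} {c : ℝ}
    (hc : ∀ᵐ x, x ∈ unitInterval → rightComp (Sum.inl j) f x
      = c + ∫ z in (0 : ℝ)..x, zeroExt unitInterval (rightComp (Sum.inl j) f') z) :
    ∀ᵐ x, x ∈ Set.Ioo (-1 : ℝ) 0 → inflow (Sum.inl j) f x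
      = (c + ∫ z in (0 : ℝ)..1, zeroExt unitInterval (rightComp (Sum.inl j) f') z)
        + ∫ z in (0 : ℝ)..x, inflow (Sum.inl j) f' z := by
  set G := zeroExt unitInterval (rightComp (Sum.inl j) f')
  have h1 := ae_comp_sub (-1) hc
  have h2 := ae_comp_sub (-1) (zeroExt_ae unitInterval (rightComp (Sum.inl j) f))
  simp only [sub_neg_eq_add] at h1 h2
  filter_upwards [inflow_inl_ae j f, h1, h2] with x h3 h1 h2 hx
  have hx1 : x + 1 ∈ (unitInterval : Set ℝ) := ⟨by linarith [hx.1], by linarith [hx.2]⟩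
  have h4 : ∫ z in (0 : ℝ)..x, inflow (Sum.inl j) f' z = ∫ z in (1 : ℝ)..(x + 1), G z := by
    rw [intervalIntegral.integral_congr_ae (g := fun z => G (z + 1)),
      intervalIntegral.integral_comp_add_right (fun z => G z), zero_add]
    filter_upwards [inflow_inl_ae j f'] with z hz _
    exact hz
  rw [h3, h2, Set.indicator_of_mem hx1, h4, add_assoc,
    intervalIntegral.integral_add_adjacent_intervals
    (intervalIntegrable_lp G 0 1) (intervalIntegrable_lp G 1 (x + 1))]
  exact h1 hx1

theorem inflow_inr_ae_eq_primitive {f f' : StateSpace p m q r} {j : Fin r} {d : ℝ}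
    (hd : ∀ᵐ x, x ∈ halfLine → leftComp j f x
      = d + ∫ z in (0 : ℝ)..x, zeroExt halfLine (leftComp j f') z) :
    ∀ᵐ x, x ∈ Set.Ioo (-1 : ℝ) 0 → inflow (Sum.inr j) f x
      = d + ∫ z in (0 : ℝ)..x, inflow (Sum.inr j) (-f') z := by
  set G := zeroExt halfLine (leftComp j f')
  filter_upwards [inflow_inr_ae j f, ae_comp_neg hd,
    ae_comp_neg (zeroExt_ae halfLine (leftComp j f))] with x h3 h1 h2 hx
  have hx1 : -x ∈ (halfLine : Set ℝ) := by
    change 0 < -x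
    linarith [hx.2]
  have h4 : ∫ z in (0 : ℝ)..x, inflow (Sum.inr j) (-f') z = ∫ z in (0 : ℝ)..(-x), G z := by
    rw [intervalIntegral.integral_congr_ae (g := fun z => -G (-z)),
      intervalIntegral.integral_neg, intervalIntegral.integral_comp_neg (fun z => G z),
      neg_zero, intervalIntegral.integral_symm, neg_neg]
    have h5 := inflow_inr_ae j (-f')
    rw [map_neg (leftComp j), map_neg (zeroExt halfLine)] at h5
    filter_upwards [h5, ae_comp_neg (Lp.coeFn_neg G)] with z h5 h6 _
    rw [h5, h6, Pi.neg_apply]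
  rw [h3, h2, Set.indicator_of_mem hx1, h4, h1 hx1]

theorem prolong_ae_eq_primitive_right {f f' : StateSpace p m q r} {i : Fin m ⊕ Fin q} {c : ℝ}
    (hc : ∀ᵐ x, x ∈ edge i → rightComp i f x
      = c + ∫ z in (0 : ℝ)..x, zeroExt (edge i) (rightComp i f') z) :
    ∀ᵐ x, x ∈ edge i → prolong B i f x = c + ∫ z in (0 : ℝ)..x, prolong B i f' z := by
  filter_upwards [prolong_ae_of_pos B i f, zeroExt_ae (edge i) (rightComp i f), hc]
    with x h1 h2 h3 hx
  have hx0 := ((startsAtZero_edge i).2 x hx).1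
  rw [h1 hx0, h2, Set.indicator_of_mem hx, h3 hx]
  congr 1
  refine intervalIntegral.integral_congr_ae ?_
  filter_upwards [prolong_ae_of_pos B i f'] with z hz hzx
  rw [Set.uIoc_of_le hx0.le] at hzx
  rw [hz hzx.1]

theorem prolong_ae_eq_primitive_left {f f' : StateSpace p m q r} {e : Fin m ⊕ Fin r → ℝ}
    (he : ∀ k, ∀ᵐ x, x ∈ Set.Ioo (-1 : ℝ) 0 →
      inflow k f x = e k + ∫ z in (0 : ℝ)..x, inflow k f' z) (i : Fin m ⊕ Fin q) :
    ∀ᵐ x, x ∈ Set.Ioo (-1 : ℝ) 0 →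
      prolong B i f x = B.mulVec e i + ∫ z in (0 : ℝ)..x, prolong B i f' z := by
  filter_upwards [prolong_ae_of_neg B i f, ae_all_iff.2 he] with x h1 h2 hx
  have h3 : ∫ z in (0 : ℝ)..x, prolong B i f' z
      = ∑ k, B i k * ∫ z in (0 : ℝ)..x, inflow k f' z := by
    rw [intervalIntegral.integral_congr_ae (g := fun z => ∑ k, B i k * inflow k f' z),
      intervalIntegral.integral_finsetSum
        (fun k _ => (intervalIntegrable_lp (inflow k f') 0 x).const_mul (B i k))]
    · simp only [intervalIntegral.integral_const_mul]
    · filter_upwards [prolong_ae_of_neg B i f', Measure.ae_ne volume (0 : ℝ)] with z h4 h5 hz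
      rw [Set.uIoc_of_ge hx.2.le] at hz
      exact h4 (lt_of_le_of_ne hz.2 h5)
  rw [h1 hx.2, h3, Matrix.mulVec, dotProduct, ← Finset.sum_add_distrib]
  refine Finset.sum_congr rfl fun k _ => ?_
  rw [h2 k hx, mul_add]

/-- For differentiable states, the difference quotients converge exactly if the boundary condition
is satisfied: it says that the prolonged components have no jump at `0`. -/
theorem tendsto_iff_boundaryCondition (hp : p ≠ ⊤) {f g : StateSpace p m q r}
    (h : IsTransportDeriv f g) :
    Tendsto (fun t : ℝ≥0 => (t : ℝ)⁻¹ • (evolve B t f - f)) (𝓝[>] 0) (𝓝 g) ↔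
      BoundaryCondition B f := by
  obtain ⟨hR, hL⟩ := h
  choose c hc using fun i => (hR i).exists_ae_eq_primitive (ordConnected_edge i)
  choose d hd using fun j => (hL j).exists_ae_eq_primitive (Set.ordConnected_Ioi)
  -- The entries of `(u(1), w(0))`.
  set e : Fin m ⊕ Fin r → ℝ := Sum.elim (fun j => c (Sum.inl j)
    + ∫ z in (0 : ℝ)..1, zeroExt unitInterval (rightComp (Sum.inl j) (-g)) z) d
  have hinflow : ∀ k, ∀ᵐ x, x ∈ Set.Ioo (-1 : ℝ) 0 →
      inflow k f x = e k + ∫ z in (0 : ℝ)..x, inflow k (-g) z := by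
    rintro (j | j)
    · exact inflow_inl_ae_eq_primitive (hc (Sum.inl j))
    · exact inflow_inr_ae_eq_primitive (hd j)
  have hvR : ∀ i v, HasValueAt (rightComp i f) 0 v ↔ v = c i := fun i v => by
    rw [hasValueAt_iff_of_ae_eq_primitive (locallyIntegrable_lp _) (hc i) (zero_mem_closure_edge i),
      intervalIntegral.integral_same, add_zero]
  have hv1 : ∀ j v, HasValueAt (rightComp (Sum.inl j) f) 1 v ↔ v = e (Sum.inl j) := fun j v =>
    hasValueAt_iff_of_ae_eq_primitive (locallyIntegrable_lp _) (hc (Sum.inl j))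
      one_mem_closure_unitInterval
  have hvL : ∀ j v, HasValueAt (leftComp j f) 0 v ↔ v = e (Sum.inr j) := fun j v => by
    rw [hasValueAt_iff_of_ae_eq_primitive (locallyIntegrable_lp _) (hd j)
      zero_mem_closure_halfLine,
      intervalIntegral.integral_same, add_zero]
    rfl
  have hBC : BoundaryCondition B f ↔ ∀ i, c i = B.mulVec e i := by
    constructor
    · rintro ⟨u₀, u₁, v₀, w₀, h1, h2, h3, h4, h5⟩
      have hc' : Sum.elim u₀ v₀ = c := by
        ext (j | j)
        · exact (hvR (Sum.inl j) _).1 (h1 j)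
        · exact (hvR (Sum.inr j) _).1 (h3 j)
      have he' : Sum.elim u₁ w₀ = e := by
        ext (j | j)
        · exact (hv1 j _).1 (h2 j)
        · exact (hvL j _).1 (h4 j)
      rw [hc', he'] at h5
      exact fun i => congrFun h5 i
    · intro h
      refine ⟨fun j => c (Sum.inl j), fun j => e (Sum.inl j), fun j => c (Sum.inr j),
        fun j => e (Sum.inr j), fun j => (hvR (Sum.inl j) _).2 rfl, fun j => (hv1 j _).2 rfl,
        fun j => (hvR (Sum.inr j) _).2 rfl, fun j => (hvL j _).2 rfl, ?_⟩
      have he' : Sum.elim (fun j => e (Sum.inl j)) (fun j => e (Sum.inr j)) = e := by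
        ext (j | j) <;> rfl
      have hc' : Sum.elim (fun j => c (Sum.inl j)) (fun j => c (Sum.inr j)) = c := by
        ext (j | j) <;> rfl
      rw [he', hc']
      exact funext h
  rw [hBC, tendsto_stateSpace_iff]
  have hLconv : ∀ j, Tendsto (fun t : ℝ≥0 => leftComp j ((t : ℝ)⁻¹ • (evolve B t f - f)))
      (𝓝[>] 0) (𝓝 (leftComp j g)) := by
    intro j
    simp only [leftComp_quotient]
    have h1 := tendsto_of_ae_eq_primitive hp (Ω := halfLine) (ε := -1) (c := d j)
      (F := zeroExt halfLine (leftComp j f)) (H := zeroExt halfLine (leftComp j g))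
      (S := (halfLine : Set ℝ)) (by
        filter_upwards [zeroExt_ae halfLine (leftComp j f), hd j] with x h1 h2 hx
        rw [h1, Set.indicator_of_mem hx, h2 hx]) (fun x hx => hx)
      (fun t ht0 _ x hx _ => by
        change 0 < x - -1 * t
        linarith [mem_halfLine.1 hx])
    rwa [neg_neg, one_smul, restr_zeroExt halfLine (leftComp j g)] at h1
  rw [and_iff_left hLconv]
  refine forall_congr' fun i => ?_
  simp only [rightComp_quotient]
  have h1 := tendsto_iff_of_ae_eq_primitive hp (startsAtZero_edge i)
    (prolong_ae_eq_primitive_right B (hc i)) (prolong_ae_eq_primitive_left B hinflow i)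
  rwa [restr_prolong B i (-g), map_neg (rightComp i), neg_neg] at h1

theorem tendsto_evolve_iff (hp : p ≠ ⊤) (f g : StateSpace p m q r) :
    Tendsto (fun t : ℝ≥0 => (t : ℝ)⁻¹ • (evolve B t f - f)) (𝓝[>] 0) (𝓝 g) ↔
      IsTransportDeriv f g ∧ BoundaryCondition B f :=
  ⟨fun h => ⟨isTransportDeriv_of_tendsto B h,
    (tendsto_iff_boundaryCondition B hp (isTransportDeriv_of_tendsto B h)).1 h⟩,
    fun h => (tendsto_iff_boundaryCondition B hp h.1).2 h.2⟩

end Generator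

end NetworkTransport

theorem mainTheorem2 (p : ℝ≥0∞) [Fact (1 ≤ p)] (hp : p ≠ ⊤) (m q r : ℕ)
    (B : Matrix (Fin m ⊕ Fin q) (Fin m ⊕ Fin r) ℝ) :
    NetworkTransport.GeneratesC0Semigroup (NetworkTransport.transportOperator p B) := by
  obtain ⟨S, hS⟩ := NetworkTransport.exists_c0Semigroup_eq_of_lt_one
    (fun t : ℝ≥0 => NetworkTransport.evolve (p := p) B t)
    (NetworkTransport.evolve_zero B)
    (fun s t hst => by
      rw [NNReal.coe_add]
      exact NetworkTransport.evolve_add B s.2 t.2 (by exact_mod_cast hst))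
    (fun f => (NetworkTransport.continuous_evolve B hp f).comp NNReal.continuous_coe)
  refine ⟨S, fun f g => ?_⟩
  rw [NetworkTransport.mem_graph_transportOperator_iff,
    ← NetworkTransport.tendsto_evolve_iff B hp f g]
  -- The generator only depends on the operators at small times.
  refine tendsto_congr' ?_
  filter_upwards [nhdsWithin_le_nhds (Iio_mem_nhds zero_lt_one)] with t ht
  rw [hS t ht]
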